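/- **Spherical Gauss–Lucas theorem.** Equip $\mathbb{CP}^1$ with the Fubini–Study metric, normalized to have diameter $\pi/2$, and $\mathcal O(n)$ with the Fubini–Study Hermitian metric and its Chern connection $\nabla$. Two points of $\mathbb{CP}^1$ are opposite if their distance is $\pi/2$, and an open hemisphere is an open ball of radius $\pi/4$. A critical point of a holomorphic section $s$ of $\mathcal O(n)$ is a point where $\nabla s=0$. Let $n\ge 2$ and let $s\in H^0(\mathbb{CP}^1,\mathcal O(n))$ be a nonzero section all of whose zeros lie in one open hemisphere. Let $P$ be the geodesic convex hull of the zeros (a geodesic segment if the zeros lie on one minimizing geodesic, a point if there is only one zero), and let $P_\infty$ be the set of the points opposite to the points of $P$. If $P$ or $P_\infty$ is a geodesic segment, its interior means the segment without its end points. Let $C_s$ be the set of critical points of $s$, $C_{s,P}=C_s\cap P$ and $C_{s,P_\infty}=C_s\cap P_\infty$. Then: 1. $C_s=C_{s,P}\cup C_{s,P_\infty}$. 2. $C_{s,P_\infty}$ is nonempty, and if $P$ is not a point, then $C_{s,P_\infty}$ is contained in the interior of $P_\infty$. 3. $C_{s,P_\infty}$ contains a point which is not a zero of $s$ and is a local maximum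 of $\log|s|^2$; if this critical point of $\log|s|^2$ is non-degenerate, it has Morse index $2$. 4. If all critical points of the function $|s|^2$ on $\mathbb{CP}^1$ are non-degenerate, then $C_{s,P}$ is nonempty and contained in the interior of $P$. -/

import Mathlib

noncomputable section

namespace SphericalGL

open scoped LinearAlgebra.Projectivization

/-- `ℂ²` with its standard Hermitian inner product. -/
abbrev C2 : Type := EuclideanSpace ℂ (Fin 2)

/-- The complex projective line `ℂℙ¹`. -/
abbrev CP1 : Type := ℙ ℂ C2

/-! ### Fubini–Study geometry of `ℂℙ¹` -/

/-- The Fubini–Study distance, normalized so that the diameter of `ℂℙ¹` is `π / 2`. -/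
def fsDist (p q : CP1) : ℝ :=
  Real.arccos (‖inner ℂ p.rep q.rep‖ / (‖p.rep‖ * ‖q.rep‖))

/-- The open hemisphere centred at `c`. -/
def openHemisphere (c : CP1) : Set CP1 := {p | fsDist c p < Real.pi / 4}

/-- The union of all minimizing geodesics from `p` to `q`: the points where the triangle
inequality is an equality.  It is the minimizing geodesic segment if `p` and `q` are not opposite,
and all of `ℂℙ¹` if they are. -/
def geodSegment (p q : CP1) : Set CP1 := {r | fsDist p r + fsDist r q = fsDist p q}

/-- Geodesic convexity: all minimizing geodesics between points of the set stay in the set. -/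
def GeodConvex (K : Set CP1) : Prop := ∀ p ∈ K, ∀ q ∈ K, geodSegment p q ⊆ K

/-- The geodesic convex hull: the intersection of all geodesically convex sets containing `S`. -/
def geodHull (S : Set CP1) : Set CP1 := ⋂₀ {K | S ⊆ K ∧ GeodConvex K}

/-- The opposite of a set: all points at distance `π / 2` from one of its points. -/
def opposite (S : Set CP1) : Set CP1 := {q | ∃ p ∈ S, fsDist p q = Real.pi / 2}

/-- The great circle with pole `c`. -/
def greatCircle (c : CP1) : Set CP1 := {p | fsDist c p = Real.pi / 4}

/-- The intersection of all great circles containing `S` (all of `ℂℙ¹` if there is none). -/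
def geodSpan (S : Set CP1) : Set CP1 := {r | ∀ c, S ⊆ greatCircle c → r ∈ greatCircle c}

/-- The interior of a geodesically convex set relative to its geodesic span: the topological
interior for a polygon, the segment without its end points for a geodesic segment. -/
def geodInterior (S : Set CP1) : Set CP1 :=
  {q | q ∈ S ∧ ∃ ε > 0, ∀ r ∈ geodSpan S, fsDist q r < ε → r ∈ S}

/-! ### Affine charts, critical points, Hessians -/

/-- The lifts of the two affine charts: `(1, z)` and `(z, 1)`. -/
def chartVec (i : Fin 2) (z : ℂ) : C2 := if i = 0 then !₂[1, z] else !₂[z, 1]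

theorem chartVec_ne_zero (i : Fin 2) (z : ℂ) : chartVec i z ≠ 0 := by
  intro h
  have h' := congrArg (fun v : C2 => v i) h
  fin_cases i <;> simp [chartVec] at h'

/-- The two affine charts `z ↦ [1 : z]` and `z ↦ [z : 1]`, as parametrizations. -/
def chart (i : Fin 2) (z : ℂ) : CP1 :=
  Projectivization.mk ℂ (chartVec i z) (chartVec_ne_zero i z)

/-- `p` is a critical point of the real function `u`. -/
def IsCriticalPt (u : CP1 → ℝ) (p : CP1) : Prop :=
  ∀ i z, chart i z = p → fderiv ℝ (fun w => u (chart i w)) z = 0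

/-- The (real) Hessian of `u` in the affine coordinate. -/
def hessian (u : CP1 → ℝ) (i : Fin 2) (z : ℂ) : ℂ →L[ℝ] ℂ →L[ℝ] ℝ :=
  fderiv ℝ (fun y => fderiv ℝ (fun w => u (chart i w)) y) z

/-- Non-degeneracy of the Hessian of `u` at a (critical) point `p`. -/
def IsNondegenerateAt (u : CP1 → ℝ) (p : CP1) : Prop :=
  ∀ i z, chart i z = p → ∀ v : ℂ, v ≠ 0 → ∃ w : ℂ, hessian u i z v w ≠ 0

/-- The Morse index of `u` at the (critical) point `p` is `k`: the largest dimension of a real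
subspace on which the Hessian is negative definite. -/
def HasMorseIndex (u : CP1 → ℝ) (p : CP1) (k : ℕ) : Prop :=
  ∀ i z, chart i z = p →
    IsGreatest {d : ℕ | ∃ W : Submodule ℝ ℂ, Module.finrank ℝ W = d ∧
      ∀ v ∈ W, v ≠ 0 → hessian u i z v v < 0} k

/-- `p` is a local maximum of `u`. -/
def IsLocalMaxAt (u : CP1 → ℝ) (p : CP1) : Prop :=
  ∃ ε > 0, ∀ q, fsDist p q < ε → u q ≤ u p

/-- The Wirtinger derivative `∂g/∂z`. -/
def wirtinger (g : ℂ → ℂ) (z : ℂ) : ℂ :=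
  (fderiv ℝ g z 1 - Complex.I * fderiv ℝ g z Complex.I) / 2

/-! ### Sections of `𝒪(n)` -/

/-- A holomorphic section of `𝒪(n)` on `ℂℙ¹`: a holomorphic function on `ℂ² ∖ {0}` that is
homogeneous of degree `n`.  (The value at `0` is irrelevant.) -/
structure HolSection (n : ℕ) where
  /-- the homogeneous function on `ℂ² ∖ {0}` -/
  toFun : C2 → ℂ
  holomorphic : DifferentiableOn ℂ toFun {0}ᶜ
  homogeneous : ∀ (c : ℂ) (v : C2), c ≠ 0 → v ≠ 0 → toFun (c • v) = c ^ n * toFun v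

namespace HolSection

variable {n : ℕ}

/-- `s` is not the zero section. -/
def IsNonzero (s : HolSection n) : Prop := ∃ v : C2, v ≠ 0 ∧ s.toFun v ≠ 0

/-- The set of zeros of `s`. -/
def zeros (s : HolSection n) : Set CP1 := {p | s.toFun p.rep = 0}

/-- The squared Fubini–Study norm `|s|²`. -/
def normSq (s : HolSection n) (p : CP1) : ℝ := ‖s.toFun p.rep‖ ^ 2 / ‖p.rep‖ ^ (2 * n)

/-- `log |s|²`. -/
def logNormSq (s : HolSection n) (p : CP1) : ℝ := Real.log (s.normSq p)

/-- The coefficient `f` of `s = f e`, where `e` is the standard frame over the `i`-th chart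
(`e = Z₀ⁿ` or `e = Z₁ⁿ`). -/
def coeff (s : HolSection n) (i : Fin 2) (z : ℂ) : ℂ := s.toFun (chartVec i z)

/-- The Fubini–Study potential `φ = n log (1 + |z|²)`; the standard frame satisfies
`|e|² = exp (-φ)`. -/
def potential (n : ℕ) (z : ℂ) : ℂ := ((n * Real.log (1 + ‖z‖ ^ 2) : ℝ) : ℂ)

/-- The Hermitian (Chern) connection of the Fubini–Study metric in the `i`-th chart: the
coefficient of `∇ₕ s = (df - f ∂φ)(h) ⊗ e` at `z`, for a tangent vector `h`. -/
def covDeriv (s : HolSection n) (i : Fin 2) (z h : ℂ) : ℂ :=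
  fderiv ℝ (s.coeff i) z h - s.coeff i z * (wirtinger (potential n) z * h)

/-- The critical points of `s`: the points where `∇ s` vanishes. -/
def criticalSet (s : HolSection n) : Set CP1 :=
  {p | ∀ i z, chart i z = p → ∀ h : ℂ, s.covDeriv i z h = 0}

/-- The geodesic convex hull of the zeros. -/
def hull (s : HolSection n) : Set CP1 := geodHull s.zeros

end HolSection

/-! ### Independence of representatives -/

theorem fsDist_mk (v w : C2) (hv : v ≠ 0) (hw : w ≠ 0) :
    fsDist (Projectivization.mk ℂ v hv) (Projectivization.mk ℂ w hw) =
      Real.arccos (‖inner ℂ v w‖ / (‖v‖ * ‖w‖)) := by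
  obtain ⟨a, ha⟩ := Projectivization.exists_smul_eq_mk_rep ℂ v hv
  obtain ⟨b, hb⟩ := Projectivization.exists_smul_eq_mk_rep ℂ w hw
  have ha0 : ‖(a : ℂ)‖ ≠ 0 := by simp
  have hb0 : ‖(b : ℂ)‖ ≠ 0 := by simp
  unfold fsDist
  rw [← ha, ← hb]
  simp only [Units.smul_def, inner_smul_left, inner_smul_right, norm_mul, norm_smul,
    RCLike.norm_conj]
  congr 1
  have hv0 : ‖v‖ ≠ 0 := by simpa using hv
  have hw0 : ‖w‖ ≠ 0 := by simpa using hw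
  field_simp

theorem HolSection.normSq_mk {n : ℕ} (s : HolSection n) (v : C2) (hv : v ≠ 0) :
    s.normSq (Projectivization.mk ℂ v hv) = ‖s.toFun v‖ ^ 2 / ‖v‖ ^ (2 * n) := by
  obtain ⟨a, ha⟩ := Projectivization.exists_smul_eq_mk_rep ℂ v hv
  have ha0 : ‖(a : ℂ)‖ ≠ 0 := by simp
  have hv0 : ‖v‖ ≠ 0 := by simpa using hv
  unfold HolSection.normSq
  rw [← ha, Units.smul_def, s.homogeneous _ _ a.ne_zero hv, norm_mul, norm_smul, norm_pow]
  field_simp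
  ring

end SphericalGL

end

/-!
Identify `ℂℙ¹` with the unit sphere of `ℝ³`. A nonzero section is a product of linear forms, so
`|s|² = K ∏ᵢ (1 - ⟪x, pᵢ⟫)`, where the `pᵢ` are the zeros. Away from the zeros, `∇ s = 0` means that
`x` is critical for this product, that is, that `∑ᵢ wᵢ pᵢ` is a multiple of `x`, where
`wᵢ = ∏_{j ≠ i} (1 - ⟪x, pⱼ⟫) > 0`. Hence `x` or `-x` is a positive combination of the `pᵢ`, so `x`
lies in the interior of `P` or of `P_∞`. Reflecting in the plane that bounds the hemisphere can
only increase the product on that hemisphere, so its maximum is attained in the opposite one.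

A critical point in `P` is a repeated zero when there is one. Otherwise suppose there is no
critical point in `P`. The map `x ↦ ∑ᵢ wᵢ pᵢ / ‖∑ᵢ wᵢ pᵢ‖` sends `P` into itself, fixes the zeros
and strictly decreases `|s|²` elsewhere. Hence the images of its iterates, which are compact and
connected, decrease to the set of zeros; this set would be connected although it is finite with at
least two points.
-/

noncomputable section

namespace SphericalGL

open scoped LinearAlgebra.Projectivization NNReal Topology
open InnerProductGeometry NormedSpace Set

section Dynamics

theorem antitone_image_iterate {X : Type*} {K : Set X} {F : X → X} (hmaps : MapsTo F K K) :
    Antitone fun n => F^[n] '' K :=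
  antitone_nat_of_succ_le fun n => by
    rintro _ ⟨x, hx, rfl⟩
    exact ⟨F x, hmaps hx, rfl⟩

variable {X : Type*} [TopologicalSpace X]

theorem isCompact_image_iterate {K : Set X} {F : X → X} (hK : IsCompact K)
    (hmaps : MapsTo F K K) (hF : ContinuousOn F K) (n : ℕ) : IsCompact (F^[n] '' K) :=
  hK.image_of_continuousOn (hF.iterate hmaps n)

variable [T2Space X]

theorem isPreconnected_iInter_of_antitone {K : ℕ → Set X} (hK : Antitone K)
    (hcomp : ∀ n, IsCompact (K n)) (hconn : ∀ n, IsPreconnected (K n)) :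
    IsPreconnected (⋂ n, K n) := by
  have hinter : IsCompact (⋂ n, K n) := (hcomp 0).of_isClosed_subset
    (isClosed_iInter fun n => (hcomp n).isClosed) (iInter_subset _ 0)
  refine (isPreconnected_iff_subset_of_fully_disjoint_closed hinter.isClosed).2
    fun A B hA hB hAB hdisj => ?_
  obtain ⟨U, V, hU, hV, hAU, hBV, hUV⟩ :=
    SeparatedNhds.of_isCompact_isCompact (hinter.inter_right hA) (hinter.inter_right hB)
      (hdisj.mono inter_subset_right inter_subset_right)
  have hcover : ⋂ n, K n ⊆ U ∪ V := fun x hx =>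
    (hAB hx).imp (fun hxA => hAU ⟨hx, hxA⟩) (fun hxB => hBV ⟨hx, hxB⟩)
  obtain ⟨n, hn⟩ := exists_subset_nhds_of_isCompact hK.directed_ge hcomp
    fun x hx => (hU.union hV).mem_nhds (hcover hx)
  rcases (hconn n).subset_or_subset hU hV hUV hn with h | h
  · exact Or.inl fun x hx => (hAB hx).resolve_right fun hxB =>
      hUV.notMem_of_mem_left (h (mem_iInter.1 hx n)) (hBV ⟨hx, hxB⟩)
  · exact Or.inr fun x hx => (hAB hx).resolve_left fun hxA =>
      hUV.notMem_of_mem_right (h (mem_iInter.1 hx n)) (hAU ⟨hx, hxA⟩)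

theorem image_iInter_image_iterate {K : Set X} {F : X → X} (hK : IsCompact K)
    (hmaps : MapsTo F K K) (hF : ContinuousOn F K) :
    F '' (⋂ n, F^[n] '' K) = ⋂ n, F^[n] '' K := by
  have hanti := antitone_image_iterate hmaps
  have hsub (n : ℕ) : F^[n] '' K ⊆ K := by simpa using hanti n.zero_le
  refine Subset.antisymm ?_ fun x hx => ?_
  · rintro _ ⟨x, hx, rfl⟩
    refine mem_iInter.2 fun n => hanti n.le_succ ?_
    obtain ⟨y, hy, rfl⟩ := mem_iInter.1 hx n
    exact ⟨y, hy, Function.iterate_succ_apply' F n y⟩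
  · have hcont (n : ℕ) : ContinuousOn F (F^[n] '' K) := hF.mono (hsub n)
    have hfibre (n : ℕ) : IsCompact (F^[n] '' K ∩ F ⁻¹' {x}) :=
      (isCompact_image_iterate hK hmaps hF n).of_isClosed_subset
        ((hcont n).preimage_isClosed_of_isClosed
          (isCompact_image_iterate hK hmaps hF n).isClosed isClosed_singleton) inter_subset_left
    have hne (n : ℕ) : (F^[n] '' K ∩ F ⁻¹' {x}).Nonempty := by
      obtain ⟨y, hy, e⟩ := mem_iInter.1 hx (n + 1)
      exact ⟨F^[n] y, ⟨y, hy, rfl⟩, (Function.iterate_succ_apply' F n y).symm.trans e⟩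
    obtain ⟨y, hy⟩ := IsCompact.nonempty_iInter_of_sequence_nonempty_isCompact_isClosed _
      (fun n => inter_subset_inter_left _ (hanti n.le_succ)) hne (hfibre 0)
      fun n => (hfibre n).isClosed
    exact ⟨y, mem_iInter.2 fun n => (mem_iInter.1 hy n).1, (mem_iInter.1 hy 0).2⟩

theorem isPreconnected_zeros_of_descent {K : Set X} {F : X → X} {u : X → ℝ}
    (hK : IsCompact K) (hconn : IsPreconnected K) (hmaps : MapsTo F K K)
    (hF : ContinuousOn F K) (hu : ContinuousOn u K) (hfix : ∀ x ∈ K, u x = 0 → F x = x)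
    (hdesc : ∀ x ∈ K, u x ≠ 0 → u (F x) < u x) : IsPreconnected {x ∈ K | u x = 0} := by
  set C := ⋂ n, F^[n] '' K
  have hanti := antitone_image_iterate hmaps
  have hcomp := isCompact_image_iterate hK hmaps hF
  have hFC : F '' C = C := image_iInter_image_iterate hK hmaps hF
  have hCK : C ⊆ K := by simpa using iInter_subset (fun n => F^[n] '' K) 0
  have hCcomp : IsCompact C := (hcomp 0).of_isClosed_subset
    (isClosed_iInter fun n => (hcomp n).isClosed) (iInter_subset _ 0)
  have hmin : ∀ x ∈ C, 0 ≤ u x := by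
    intro x hx
    obtain ⟨y, hy, hyle⟩ := hCcomp.exists_isMinOn ⟨x, hx⟩ (hu.mono hCK)
    have hy0 : u y = 0 := by
      by_contra h
      exact (hdesc y (hCK hy) h).not_ge (hyle (hFC ▸ mem_image_of_mem F hy))
    exact hy0 ▸ hyle hx
  have hmax : ∀ x ∈ C, u x ≤ 0 := by
    intro x hx
    obtain ⟨y, hy, hyge⟩ := hCcomp.exists_isMaxOn ⟨x, hx⟩ (hu.mono hCK)
    obtain ⟨w, hw, rfl⟩ := hFC.symm ▸ hy
    have hw0 : u w = 0 := by
      by_contra h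
      exact (hdesc w (hCK hw) h).not_ge (hyge hw)
    calc u x ≤ u (F w) := hyge hx
      _ = 0 := by rw [hfix w (hCK hw) hw0, hw0]
  have hCeq : {x ∈ K | u x = 0} = C := by
    refine Subset.antisymm (fun x hx => mem_iInter.2 fun n => ⟨x, hx.1, ?_⟩)
      fun x hx => ⟨hCK hx, (hmax x hx).antisymm (hmin x hx)⟩
    exact Function.iterate_fixed (hfix x hx.1 hx.2) n
  rw [hCeq]
  exact isPreconnected_iInter_of_antitone hanti hcomp fun n =>
    hconn.image _ (hF.iterate hmaps n)

end Dynamics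

section Cone

variable {ι : Type*} [Fintype ι]

section Module

variable {E : Type*} [AddCommGroup E] [Module ℝ E]

/-- The strictly positive combinations of the `p i`; these form the interior of the convex cone
generated by the `p i`, relative to its linear span. -/
def openCone (p : ι → E) : Set E := {x | ∃ t : ι → ℝ, (∀ i, 0 < t i) ∧ ∑ i, t i • p i = x}

variable {p : ι → E} {x : E}

theorem smul_mem_openCone {a : ℝ} (ha : 0 < a) (hx : x ∈ openCone p) : a • x ∈ openCone p := by
  obtain ⟨t, ht, rfl⟩ := hx
  exact ⟨fun i => a * t i, fun i => mul_pos ha (ht i), by simp only [mul_smul, Finset.smul_sum]⟩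

theorem mem_openCone_neg : x ∈ openCone (-p) ↔ -x ∈ openCone p := by
  simp only [openCone, mem_ofPred_eq, Pi.neg_apply, smul_neg, Finset.sum_neg_distrib,
    neg_eq_iff_eq_neg]

theorem openCone_subset_span_nnreal : openCone p ⊆ Submodule.span ℝ≥0 (range p) := by
  rintro _ ⟨t, ht, rfl⟩
  refine Submodule.sum_mem _ fun i _ => ?_
  exact Submodule.smul_mem _ (⟨t i, (ht i).le⟩ : ℝ≥0) (Submodule.subset_span (mem_range_self i))

theorem mem_span_nnreal_range_neg {ι : Type*} {p : ι → E} :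
    x ∈ Submodule.span ℝ≥0 (range (-p)) ↔ -x ∈ Submodule.span ℝ≥0 (range p) := by
  have hrange : range (-p) = (LinearEquiv.neg ℝ≥0).toLinearMap '' range p :=
    range_comp _ p
  rw [hrange, ← Submodule.map_span, Submodule.mem_map_equiv]
  rfl

end Module

variable {E : Type*} [NormedAddCommGroup E]

theorem openCone_mem_nhdsWithin_span [NormedSpace ℝ E] {p : ι → E} {x : E}
    (hx : x ∈ openCone p) : openCone p ∈ 𝓝[Submodule.span ℝ (range p)] x := by
  obtain ⟨t, ht, rfl⟩ := hx
  rw [← Fintype.range_linearCombination ℝ p]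
  let T := (Fintype.linearCombination ℝ p).rangeRestrict
  have hT : IsOpenMap T := T.isOpenMap_of_finiteDimensional
    (Fintype.linearCombination ℝ p).surjective_rangeRestrict
  have hpos : {u : ι → ℝ | ∀ i, 0 < u i} ∈ 𝓝 t :=
    Filter.eventually_all.2 fun i =>
      (continuous_apply i).continuousAt.eventually (lt_mem_nhds (ht i))
  refine Filter.mem_of_superset (mem_nhds_subtype_iff_nhdsWithin.1 (hT.image_mem_nhds hpos)) ?_
  rintro _ ⟨_, ⟨u, hu, rfl⟩, rfl⟩
  exact ⟨u, hu, rfl⟩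

variable [InnerProductSpace ℝ E]

theorem inner_pos_of_mem_span_nnreal {S : Set E} {c x : E} (hc : ∀ y ∈ S, 0 < inner ℝ c y)
    (hx : x ∈ Submodule.span ℝ≥0 S) (hx0 : x ≠ 0) : 0 < inner ℝ c x := by
  suffices h : x = 0 ∨ 0 < inner ℝ c x from h.resolve_left hx0
  clear hx0
  induction hx using Submodule.span_induction with
  | mem y hy => exact Or.inr (hc y hy)
  | zero => exact Or.inl rfl
  | add y z _ _ hy hz =>
    rcases hy with rfl | hy
    · rwa [zero_add]
    rcases hz with rfl | hz
    · rw [add_zero]; exact Or.inr hy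
    · rw [inner_add_right]; exact Or.inr (add_pos hy hz)
  | smul a y _ hy =>
    rcases hy with rfl | hy
    · exact Or.inl (smul_zero a)
    rcases eq_zero_or_pos a with rfl | ha
    · exact Or.inl (zero_smul _ y)
    · rw [NNReal.smul_def, inner_smul_right]
      exact Or.inr (mul_pos (NNReal.coe_pos.2 ha) hy)

theorem inner_pos_of_mem_openCone [Nonempty ι] {p : ι → E} {c x : E}
    (hc : ∀ i, 0 < inner ℝ c (p i)) (hx : x ∈ openCone p) : 0 < inner ℝ c x := by
  obtain ⟨t, ht, rfl⟩ := hx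
  simp only [inner_sum, inner_smul_right]
  exact Finset.sum_pos (fun i _ => mul_pos (ht i) (hc i)) Finset.univ_nonempty

end Cone

section ChordProduct

variable {E : Type*} [NormedAddCommGroup E] [InnerProductSpace ℝ E]
  {ι : Type*} [Fintype ι] {p : ι → E} {x y c : E}

/-- On unit vectors, the product of the numbers `‖x - p i‖ ^ 2 / 2`. -/
def chordProd (p : ι → E) (x : E) : ℝ := ∏ i, (1 - inner ℝ x (p i))

theorem continuous_chordProd : Continuous (chordProd p) := by
  unfold chordProd
  fun_prop

theorem one_sub_inner_nonneg (hx : ‖x‖ = 1) (hy : ‖y‖ = 1) : 0 ≤ 1 - inner ℝ x y :=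
  sub_nonneg.2 (by simpa [hx, hy] using real_inner_le_norm x y)

theorem one_sub_inner_pos (hx : ‖x‖ = 1) (hy : ‖y‖ = 1) (h : x ≠ y) : 0 < 1 - inner ℝ x y :=
  sub_pos.2 ((inner_lt_one_iff_real_of_norm_eq_one hx hy).2 h)

theorem chordProd_nonneg (hp : ∀ i, ‖p i‖ = 1) (hx : ‖x‖ = 1) : 0 ≤ chordProd p x :=
  Finset.prod_nonneg fun i _ => one_sub_inner_nonneg hx (hp i)

theorem chordProd_eq_zero_iff (hp : ∀ i, ‖p i‖ = 1) (hx : ‖x‖ = 1) :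
    chordProd p x = 0 ↔ ∃ i, x = p i := by
  simp only [chordProd, Finset.prod_eq_zero_iff, Finset.mem_univ, true_and, sub_eq_zero,
    eq_comm (a := (1 : ℝ)), inner_eq_one_iff_of_norm_eq_one hx (hp _)]

theorem inner_reflection_orthogonal_lt (hx : 0 < inner ℝ c x) (hy : 0 < inner ℝ c y) :
    inner ℝ ((ℝ ∙ c)ᗮ.reflection x) y < inner ℝ x y := by
  have hc : c ≠ 0 := by
    rintro rfl
    simp at hx
  have hpos : 0 < inner ℝ c x / ‖c‖ ^ 2 * inner ℝ c y :=
    mul_pos (div_pos hx (sq_pos_of_pos (norm_pos_iff.2 hc))) hy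
  rw [Submodule.reflection_orthogonal_apply, Submodule.reflection_singleton_apply, neg_sub,
    inner_sub_left, two_smul, inner_add_left, real_inner_smul_left]
  simp only [RCLike.ofReal_real_eq_id, id_eq]
  linarith

theorem chordProd_lt_of_inner_lt [Nonempty ι] (hp : ∀ i, ‖p i‖ = 1) (hx : ‖x‖ = 1)
    (h : ∀ i, inner ℝ y (p i) < inner ℝ x (p i)) : chordProd p x < chordProd p y := by
  have hlt (i : ι) : 1 - inner ℝ x (p i) < 1 - inner ℝ y (p i) := sub_lt_sub_left (h i) 1
  have hy (i : ι) : 0 < 1 - inner ℝ y (p i) := (one_sub_inner_nonneg hx (hp i)).trans_lt (hlt i)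
  by_cases h0 : ∃ i, x = p i
  · rw [(chordProd_eq_zero_iff hp hx).2 h0]
    exact Finset.prod_pos fun i _ => hy i
  · push Not at h0
    exact Finset.prod_lt_prod_of_nonempty (fun i _ => one_sub_inner_pos hx (hp i) (h0 i))
      (fun i _ => hlt i) Finset.univ_nonempty

theorem exists_isMaxOn_chordProd [Nonempty ι] [FiniteDimensional ℝ E] (hp : ∀ i, ‖p i‖ = 1)
    (hc : ∀ i, 0 < inner ℝ c (p i)) :
    ∃ x, ‖x‖ = 1 ∧ IsMaxOn (chordProd p) (Metric.sphere 0 1) x ∧ inner ℝ c x ≤ 0 := by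
  obtain ⟨i₀⟩ := ‹Nonempty ι›
  obtain ⟨x, hx, hmax⟩ := (isCompact_sphere (0 : E) 1).exists_isMaxOn
    ⟨p i₀, mem_sphere_zero_iff_norm.2 (hp i₀)⟩ (continuous_chordProd (p := p)).continuousOn
  rw [mem_sphere_zero_iff_norm] at hx
  refine ⟨x, hx, hmax, not_lt.1 fun hcx => ?_⟩
  -- The mirror image of `x` in the hyperplane `cᗮ` is farther away from every `p i`.
  have hlt : chordProd p x < chordProd p ((ℝ ∙ c)ᗮ.reflection x) :=
    have : Nonempty ι := ⟨i₀⟩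
    chordProd_lt_of_inner_lt hp hx fun i => inner_reflection_orthogonal_lt hcx (hc i)
  refine hlt.not_ge (hmax (mem_sphere_zero_iff_norm.2 ?_))
  rw [LinearIsometryEquiv.norm_map, hx]

variable [DecidableEq ι]

/-- The product of all factors of `chordProd p x` but the `i`-th. -/
def chordWeight (p : ι → E) (x : E) (i : ι) : ℝ :=
  ∏ j ∈ Finset.univ.erase i, (1 - inner ℝ x (p j))

/-- Minus the gradient of `chordProd p`. -/
def descentField (p : ι → E) (x : E) : E := ∑ i, chordWeight p x i • p i

theorem continuous_descentField : Continuous (descentField p) := by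
  unfold descentField chordWeight
  fun_prop

theorem one_sub_inner_mul_chordWeight (i : ι) :
    (1 - inner ℝ x (p i)) * chordWeight p x i = chordProd p x :=
  Finset.mul_prod_erase _ (fun j => 1 - inner ℝ x (p j)) (Finset.mem_univ i)

theorem chordWeight_nonneg (hp : ∀ i, ‖p i‖ = 1) (hx : ‖x‖ = 1) (i : ι) :
    0 ≤ chordWeight p x i :=
  Finset.prod_nonneg fun j _ => one_sub_inner_nonneg hx (hp j)

theorem chordWeight_pos (hp : ∀ i, ‖p i‖ = 1) (hx : ‖x‖ = 1) {i : ι}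
    (hne : ∀ j, j ≠ i → x ≠ p j) : 0 < chordWeight p x i :=
  Finset.prod_pos fun j hj => one_sub_inner_pos hx (hp j) (hne j (Finset.ne_of_mem_erase hj))

theorem descentField_apply_self (hp : ∀ i, ‖p i‖ = 1) (i : ι) :
    descentField p (p i) = chordWeight p (p i) i • p i := by
  refine Finset.sum_eq_single_of_mem i (Finset.mem_univ i) fun j _ hj => ?_
  have hzero : 1 - inner ℝ (p i) (p i) = 0 := by
    rw [real_inner_self_eq_norm_sq, hp, one_pow, sub_self]
  rw [chordWeight, Finset.prod_eq_zero (Finset.mem_erase.2 ⟨hj.symm, Finset.mem_univ i⟩) hzero,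
    zero_smul]

theorem descentField_mem_openCone (hp : ∀ i, ‖p i‖ = 1) (hx : ‖x‖ = 1) (hxp : ∀ i, x ≠ p i) :
    descentField p x ∈ openCone p :=
  ⟨chordWeight p x, fun _ => chordWeight_pos hp hx fun j _ => hxp j, rfl⟩

theorem mem_openCone_or_neg_mem_of_descentField_eq_smul [Nonempty ι] (hp : ∀ i, ‖p i‖ = 1)
    (hc : ∀ i, 0 < inner ℝ c (p i)) (hx : ‖x‖ = 1) (hxp : ∀ i, x ≠ p i) {a : ℝ}
    (ha : descentField p x = a • x) : x ∈ openCone p ∨ -x ∈ openCone p := by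
  have hmem : a • x ∈ openCone p := ha ▸ descentField_mem_openCone hp hx hxp
  rcases lt_trichotomy a 0 with hneg | rfl | hpos
  · refine Or.inr ?_
    simpa [smul_smul, hneg.ne] using smul_mem_openCone (neg_pos.2 (inv_lt_zero.2 hneg)) hmem
  · simpa using inner_pos_of_mem_openCone hc hmem
  · refine Or.inl ?_
    simpa [smul_smul, hpos.ne'] using smul_mem_openCone (inv_pos.2 hpos) hmem

theorem hasStrictFDerivAt_chordProd :
    HasStrictFDerivAt (chordProd p) (-innerSL ℝ (descentField p x)) x := by
  have hfactor (i : ι) : HasStrictFDerivAt (fun y => 1 - inner ℝ y (p i)) (-innerSL ℝ (p i)) x := by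
    simpa only [innerSL_apply_apply, real_inner_comm] using
      ((innerSL ℝ (p i)).hasStrictFDerivAt (x := x)).const_sub 1
  refine (HasStrictFDerivAt.finsetProd fun i _ => hfactor i).congr_fderiv ?_
  simp only [descentField, chordWeight, map_sum, map_smul, smul_neg, Finset.sum_neg_distrib]

theorem exists_descentField_eq_smul_of_isMaxOn [CompleteSpace E] (hx : ‖x‖ = 1)
    (hmax : IsMaxOn (chordProd p) (Metric.sphere 0 1) x) : ∃ a : ℝ, descentField p x = a • x := by
  have hextr : IsLocalExtrOn (chordProd p) {y | ‖y‖ ^ 2 = ‖x‖ ^ 2} x := by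
    refine Or.inr (IsMaxOn.localize fun y hy => hmax ?_)
    rw [mem_sphere_zero_iff_norm, ← hx]
    exact (pow_left_inj₀ (norm_nonneg y) (norm_nonneg x) two_ne_zero).1 hy
  obtain ⟨a, b, hab, hmult⟩ := hextr.exists_multipliers_of_hasStrictFDerivAt_1d
    (hasStrictFDerivAt_norm_sq x) hasStrictFDerivAt_chordProd
  have hcomb : (2 * a) • x = b • descentField p x := by
    refine ext_inner_left ℝ fun v => ?_
    have hv : a * (2 * inner ℝ x v) + b * -inner ℝ (descentField p x) v = 0 := by
      simpa using DFunLike.congr_fun hmult v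
    rw [inner_smul_right, inner_smul_right, real_inner_comm x, real_inner_comm (descentField p x)]
    linarith
  have hb : b ≠ 0 := by
    rintro rfl
    have hx0 : x ≠ 0 := norm_ne_zero_iff.1 (hx ▸ one_ne_zero)
    have ha : a = 0 := by simpa [hx0] using hcomb
    exact hab (by rw [ha]; rfl)
  exact ⟨b⁻¹ * (2 * a), by rw [mul_smul, hcomb, inv_smul_smul₀ hb]⟩

theorem inner_descentField_pos (hp : ∀ i, ‖p i‖ = 1) (hinj : Function.Injective p)
    [Nonempty ι] (hc : ∀ i, 0 < inner ℝ c (p i)) (hx : ‖x‖ = 1) :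
    0 < inner ℝ c (descentField p x) := by
  by_cases h : ∃ i, x = p i
  · obtain ⟨i, rfl⟩ := h
    rw [descentField_apply_self hp, inner_smul_right]
    exact mul_pos (chordWeight_pos hp hx fun j hj => hinj.ne hj.symm) (hc i)
  · exact inner_pos_of_mem_openCone hc (descentField_mem_openCone hp hx (not_exists.1 h))

theorem normalize_descentField_apply_self (hp : ∀ i, ‖p i‖ = 1) (hinj : Function.Injective p)
    (i : ι) : normalize (descentField p (p i)) = p i := by
  rw [descentField_apply_self hp,
    normalize_smul_of_pos (chordWeight_pos hp (hp i) fun j hj => hinj.ne hj.symm),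
    normalize_eq_self_of_norm_eq_one (hp i)]

theorem chordProd_lt_of_inner_descentField_sub_pos (hp : ∀ i, ‖p i‖ = 1) (hx : ‖x‖ = 1)
    (hy : ‖y‖ = 1) (hxp : ∀ i, x ≠ p i) (h : 0 < inner ℝ (descentField p x) (y - x)) :
    chordProd p y < chordProd p x := by
  have hpos (i : ι) : 0 < 1 - inner ℝ x (p i) := one_sub_inner_pos hx (hp i) (hxp i)
  have hprod : 0 < chordProd p x := Finset.prod_pos fun i _ => hpos i
  let r (i : ι) : ℝ := inner ℝ (y - x) (p i) / (1 - inner ℝ x (p i))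
  have hfactor (i : ι) : 1 - inner ℝ y (p i) ≤ (1 - inner ℝ x (p i)) * Real.exp (-r i) := by
    calc 1 - inner ℝ y (p i) = (1 - inner ℝ x (p i)) * (-r i + 1) := by
          have := (hpos i).ne'
          simp only [r, inner_sub_left]
          field_simp
          ring
      _ ≤ _ := mul_le_mul_of_nonneg_left (Real.add_one_le_exp _) (hpos i).le
  have hsum : chordProd p x * ∑ i, r i = inner ℝ (descentField p x) (y - x) := by
    rw [descentField, sum_inner, Finset.mul_sum]
    refine Finset.sum_congr rfl fun i _ => ?_
    rw [real_inner_smul_left, real_inner_comm, ← one_sub_inner_mul_chordWeight i]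
    have := (hpos i).ne'
    simp only [r]
    field_simp
  have hsum_pos : 0 < ∑ i, r i := by
    rw [← hsum] at h
    exact pos_of_mul_pos_right h hprod.le
  calc chordProd p y ≤ ∏ i, (1 - inner ℝ x (p i)) * Real.exp (-r i) :=
        Finset.prod_le_prod (fun i _ => one_sub_inner_nonneg hy (hp i)) fun i _ => hfactor i
    _ = chordProd p x * Real.exp (-∑ i, r i) := by
        rw [Finset.prod_mul_distrib, ← Real.exp_sum, Finset.sum_neg_distrib, chordProd]
    _ < chordProd p x := mul_lt_of_lt_one_right hprod (by simpa using hsum_pos)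

theorem chordProd_normalize_descentField_lt (hp : ∀ i, ‖p i‖ = 1) (hx : ‖x‖ = 1)
    (hxp : ∀ i, x ≠ p i) (hcrit : ¬∃ a : ℝ, descentField p x = a • x) :
    chordProd p (normalize (descentField p x)) < chordProd p x := by
  set w := descentField p x
  have hw : w ≠ 0 := fun h => hcrit ⟨0, by rw [h, zero_smul]⟩
  refine chordProd_lt_of_inner_descentField_sub_pos hp hx (norm_normalize_eq_one_iff.2 hw) hxp ?_
  have hinner : inner ℝ w (normalize w) = ‖w‖ := by
    nth_rw 1 [← norm_smul_normalize w]
    rw [real_inner_smul_left, real_inner_self_eq_norm_sq, norm_normalize_eq_one_iff.2 hw, one_pow,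
      mul_one]
  have hlt : inner ℝ w x < ‖w‖ := by
    refine lt_of_le_of_ne (by simpa [hx] using real_inner_le_norm w x) fun h => hcrit ⟨‖w‖, ?_⟩
    have := inner_eq_norm_mul_iff_real.1 (show inner ℝ w x = ‖w‖ * ‖x‖ by rw [h, hx, mul_one])
    simpa [hx] using this
  rw [inner_sub_right, hinner]
  exact sub_pos.2 hlt

end ChordProduct

section SphericalHull

variable {E : Type*} [NormedAddCommGroup E] {ι : Type*}

section NormedSpace

variable [NormedSpace ℝ E] {p : ι → E}

theorem continuousOn_normalize :
    ContinuousOn (normalize : E → E) {0}ᶜ := by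
  unfold NormedSpace.normalize
  exact (continuous_norm.continuousOn.inv₀ fun x hx => norm_ne_zero_iff.2 hx).smul continuousOn_id

/-- The geodesic convex hull, on the unit sphere, of a family of unit vectors contained in an open
hemisphere. -/
def sphericalHull (p : ι → E) : Set E :=
  normalize '' convexHull ℝ (range p)

theorem mem_sphericalHull_self (hp : ∀ i, ‖p i‖ = 1) (i : ι) : p i ∈ sphericalHull p :=
  ⟨p i, subset_convexHull ℝ _ (mem_range_self i), normalize_eq_self_of_norm_eq_one (hp i)⟩

theorem normalize_sum_smul_mem_sphericalHull [Fintype ι] {w : ι → ℝ} (hw : ∀ i, 0 ≤ w i)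
    (hpos : 0 < ∑ i, w i) : normalize (∑ i, w i • p i) ∈ sphericalHull p := by
  refine ⟨Finset.univ.centerMass w p, ?_, ?_⟩
  · exact Finset.centerMass_mem_convexHull _ (fun i _ => hw i) hpos fun i _ => mem_range_self i
  · rw [Finset.centerMass, normalize_smul_of_pos (inv_pos.2 hpos)]

theorem sphericalHull_subset_span_nnreal :
    sphericalHull p ⊆ Submodule.span ℝ≥0 (range p) := by
  rintro _ ⟨y, hy, rfl⟩
  have hcone := convexHull_min Submodule.subset_span (PointedCone.hull ℝ (range p)).convex hy
  exact Submodule.smul_mem _ (⟨‖y‖⁻¹, by positivity⟩ : ℝ≥0) hcone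

end NormedSpace

variable [InnerProductSpace ℝ E] {p : ι → E} {c : E}

theorem convexHull_subset_compl_zero (hc : ∀ i, 0 < inner ℝ c (p i)) :
    convexHull ℝ (range p) ⊆ {0}ᶜ := by
  have hhalf : convexHull ℝ (range p) ⊆ {x | 0 < inner ℝ c x} :=
    convexHull_min (range_subset_iff.2 hc) ((convex_Ioi (0 : ℝ)).linear_preimage (innerₛₗ ℝ c))
  rintro _ hx rfl
  simpa using hhalf hx

theorem isCompact_sphericalHull [Finite ι] (hc : ∀ i, 0 < inner ℝ c (p i)) :
    IsCompact (sphericalHull p) :=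
  ((finite_range p).isCompact_convexHull ℝ).image_of_continuousOn
    (continuousOn_normalize.mono (convexHull_subset_compl_zero hc))

theorem isPreconnected_sphericalHull (hc : ∀ i, 0 < inner ℝ c (p i)) :
    IsPreconnected (sphericalHull p) :=
  (convex_convexHull ℝ _).isPreconnected.image _
    (continuousOn_normalize.mono (convexHull_subset_compl_zero hc))

theorem norm_eq_one_of_mem_sphericalHull (hc : ∀ i, 0 < inner ℝ c (p i)) {x : E}
    (hx : x ∈ sphericalHull p) : ‖x‖ = 1 := by
  obtain ⟨y, hy, rfl⟩ := hx
  exact norm_normalize_eq_one_iff.2 (convexHull_subset_compl_zero hc hy)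

theorem exists_equilibrium_mem_sphericalHull [Fintype ι] [DecidableEq ι] [Nontrivial ι]
    (hp : ∀ i, ‖p i‖ = 1) (hinj : Function.Injective p) (hc : ∀ i, 0 < inner ℝ c (p i)) :
    ∃ x ∈ sphericalHull p, (∀ i, x ≠ p i) ∧ ∃ a : ℝ, descentField p x = a • x := by
  by_contra! hnone
  have hunit {x : E} (hx : x ∈ sphericalHull p) : ‖x‖ = 1 :=
    norm_eq_one_of_mem_sphericalHull hc hx
  have hfield {x : E} (hx : x ∈ sphericalHull p) : 0 < inner ℝ c (descentField p x) :=
    inner_descentField_pos hp hinj hc (hunit hx)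
  have hne {x : E} (hx : x ∈ sphericalHull p) : descentField p x ≠ 0 := fun h => by
    simpa [h] using hfield hx
  have hzero : IsPreconnected {x ∈ sphericalHull p | chordProd p x = 0} := by
    refine isPreconnected_zeros_of_descent (F := fun x => normalize (descentField p x))
      (isCompact_sphericalHull hc) (isPreconnected_sphericalHull hc) ?_
      (continuousOn_normalize.comp continuous_descentField.continuousOn fun x hx => hne hx)
      continuous_chordProd.continuousOn ?_ ?_
    · intro x hx
      have hw := chordWeight_nonneg hp (hunit hx)
      refine normalize_sum_smul_mem_sphericalHull hw
        ((Finset.sum_nonneg fun i _ => hw i).lt_of_ne' fun h => hne hx ?_)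
      have hw0 := (Finset.sum_eq_zero_iff_of_nonneg fun i _ => hw i).1 h
      exact Finset.sum_eq_zero fun i hi => by rw [hw0 i hi, zero_smul]
    · intro x hx h0
      obtain ⟨i, rfl⟩ := (chordProd_eq_zero_iff hp (hunit hx)).1 h0
      exact normalize_descentField_apply_self hp hinj i
    · intro x hx h0
      have hxp : ∀ i, x ≠ p i := not_exists.1 (mt (chordProd_eq_zero_iff hp (hunit hx)).2 h0)
      exact chordProd_normalize_descentField_lt hp (hunit hx) hxp
        (not_exists.2 (hnone x hx hxp))
  have hfinite : {x ∈ sphericalHull p | chordProd p x = 0}.Finite :=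
    (finite_range p).subset fun x hx =>
      ((chordProd_eq_zero_iff hp (hunit hx.1)).1 hx.2).imp fun _ h => h.symm
  obtain ⟨i, j, hij⟩ := exists_pair_ne ι
  have hmem (k : ι) : p k ∈ {x ∈ sphericalHull p | chordProd p x = 0} :=
    ⟨mem_sphericalHull_self hp k, (chordProd_eq_zero_iff hp (hp k)).2 ⟨k, rfl⟩⟩
  exact hij (hinj (hfinite.countable.isTotallyDisconnected _ Subset.rfl hzero (hmem i) (hmem j)))

end SphericalHull

section BlochSphere

/-- Euclidean three-space, which contains the Bloch sphere as its unit sphere. -/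
abbrev R3 : Type := EuclideanSpace ℝ (Fin 3)

/-- The Hopf map, normalised to unit length: it identifies the line spanned by `v` with a point of
the unit sphere. It takes the junk value `0` at `v = 0`. -/
def bloch (v : C2) : R3 :=
  (‖v‖ ^ 2)⁻¹ • !₂[(v 0).re ^ 2 + (v 0).im ^ 2 - (v 1).re ^ 2 - (v 1).im ^ 2,
    2 * ((v 0).re * (v 1).re + (v 0).im * (v 1).im),
    2 * ((v 0).re * (v 1).im - (v 0).im * (v 1).re)]

theorem norm_sq_C2 (v : C2) :
    ‖v‖ ^ 2 = (v 0).re ^ 2 + (v 0).im ^ 2 + (v 1).re ^ 2 + (v 1).im ^ 2 := by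
  simp only [EuclideanSpace.norm_sq_eq, Fin.sum_univ_two, Complex.sq_norm, Complex.normSq_apply]
  ring

theorem inner_C2 (v w : C2) :
    inner ℂ v w = w 0 * (starRingEnd ℂ) (v 0) + w 1 * (starRingEnd ℂ) (v 1) := by
  simp only [PiLp.inner_apply, Fin.sum_univ_two, RCLike.inner_apply]

theorem inner_R3 (x y : R3) : inner ℝ x y = x 0 * y 0 + x 1 * y 1 + x 2 * y 2 := by
  simp only [PiLp.inner_apply, Fin.sum_univ_three, RCLike.inner_apply, conj_trivial, mul_comm]

theorem one_add_inner_bloch {v w : C2} (hv : v ≠ 0) (hw : w ≠ 0) :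
    1 + inner ℝ (bloch v) (bloch w) = 2 * (‖inner ℂ v w‖ ^ 2 / (‖v‖ ^ 2 * ‖w‖ ^ 2)) := by
  have _ : ‖v‖ ^ 2 ≠ 0 := by simpa using hv
  have _ : ‖w‖ ^ 2 ≠ 0 := by simpa using hw
  simp only [bloch, inner_smul_left, inner_smul_right, inner_R3, Complex.sq_norm, inner_C2,
    Complex.normSq_apply, Matrix.cons_val, Complex.add_re, Complex.add_im,
    Complex.mul_re, Complex.mul_im, Complex.conj_re, Complex.conj_im, conj_trivial]
  field_simp
  rw [norm_sq_C2, norm_sq_C2]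
  ring

theorem norm_bloch {v : C2} (hv : v ≠ 0) : ‖bloch v‖ = 1 := by
  have hv0 : ‖v‖ ≠ 0 := norm_ne_zero_iff.2 hv
  have hinner : ‖inner ℂ v v‖ = ‖v‖ ^ 2 := by
    rw [inner_self_eq_norm_sq_to_K, norm_pow, RCLike.norm_ofReal, abs_norm]
  have h := one_add_inner_bloch hv hv
  rw [real_inner_self_eq_norm_sq, hinner, ← pow_two (‖v‖ ^ 2),
    div_self (pow_ne_zero _ (pow_ne_zero _ hv0))] at h
  exact (pow_eq_one_iff_of_nonneg (norm_nonneg _) two_ne_zero).1 (by linarith)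

theorem exists_bloch_eq {x : R3} (hx : ‖x‖ = 1) : ∃ v : C2, v ≠ 0 ∧ bloch v = x := by
  have hsum : x 0 ^ 2 + x 1 ^ 2 + x 2 ^ 2 = 1 := by
    simpa [hx, Fin.sum_univ_three] using (EuclideanSpace.norm_sq_eq x).symm
  by_cases h : x 0 = -1
  · refine ⟨!₂[0, 1], fun h0 => by simpa using congrArg (fun v : C2 => v 1) h0, ?_⟩
    have h1 : x 1 = 0 := by nlinarith
    have h2 : x 2 = 0 := by nlinarith
    ext k
    fin_cases k <;> simp [bloch, norm_sq_C2, h, h1, h2]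
  · have hne : 1 + x 0 ≠ 0 := fun h0 => h (by linarith)
    let v : C2 := !₂[((1 + x 0 : ℝ) : ℂ), ⟨x 1, x 2⟩]
    have hnorm : ‖v‖ ^ 2 = 2 * (1 + x 0) := by
      simp only [v, norm_sq_C2, Matrix.cons_val, Complex.ofReal_re,
        Complex.ofReal_im]
      linarith
    refine ⟨v, fun h0 => hne ?_, ?_⟩
    · exact Complex.ofReal_eq_zero.1 (congrArg (fun v : C2 => v 0) h0)
    · ext k
      rw [bloch, hnorm]
      fin_cases k <;>
        simp only [v, PiLp.smul_apply, smul_eq_mul, Complex.ofReal_re, Complex.ofReal_im,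
          Fin.zero_eta, Fin.mk_one, Fin.reduceFinMk, Matrix.cons_val] <;> field_simp
      all_goals linarith

theorem bloch_smul {a : ℂ} (ha : a ≠ 0) (v : C2) : bloch (a • v) = bloch v := by
  rcases eq_or_ne v 0 with rfl | hv
  · rw [smul_zero]
  have _ : ‖v‖ ^ 2 ≠ 0 := by simpa using hv
  have ha0 : a.re ^ 2 + a.im ^ 2 ≠ 0 := by
    have : ‖a‖ ^ 2 ≠ 0 := by simpa using ha
    rwa [Complex.sq_norm, Complex.normSq_apply, ← pow_two, ← pow_two] at this
  have hnorm : ‖a • v‖ ^ 2 = (a.re ^ 2 + a.im ^ 2) * ‖v‖ ^ 2 := by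
    rw [norm_smul, mul_pow, Complex.sq_norm, Complex.normSq_apply, ← pow_two, ← pow_two]
  ext k
  rw [bloch, hnorm, bloch]
  fin_cases k <;>
    simp only [PiLp.smul_apply, smul_eq_mul, Complex.mul_re, Complex.mul_im, Fin.zero_eta,
      Fin.mk_one, Fin.reduceFinMk, Matrix.cons_val] <;> field_simp <;> ring

/-- The isometry (up to a factor `2`) between `ℂℙ¹` and the unit sphere. -/
def spherePoint (p : CP1) : R3 := bloch p.rep

theorem norm_spherePoint (p : CP1) : ‖spherePoint p‖ = 1 := norm_bloch p.rep_nonzero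

theorem spherePoint_ne_zero (p : CP1) : spherePoint p ≠ 0 :=
  norm_ne_zero_iff.1 (by rw [norm_spherePoint]; exact one_ne_zero)

theorem spherePoint_mk (v : C2) (hv : v ≠ 0) :
    spherePoint (Projectivization.mk ℂ v hv) = bloch v := by
  obtain ⟨a, ha⟩ := Projectivization.exists_smul_eq_mk_rep ℂ v hv
  rw [spherePoint, ← ha, Units.smul_def, bloch_smul a.ne_zero]

theorem exists_spherePoint_eq {x : R3} (hx : ‖x‖ = 1) : ∃ p, spherePoint p = x := by
  obtain ⟨v, hv, rfl⟩ := exists_bloch_eq hx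
  exact ⟨_, spherePoint_mk v hv⟩

theorem exists_eq_smul_spherePoint {x : R3} (hx : x ≠ 0) :
    ∃ p, ∃ r : ℝ, 0 < r ∧ x = r • spherePoint p := by
  obtain ⟨p, hp⟩ := exists_spherePoint_eq (norm_normalize_eq_one_iff.2 hx)
  exact ⟨p, ‖x‖, norm_pos_iff.2 hx, by rw [hp, norm_smul_normalize]⟩

theorem fsDist_eq_angle (p q : CP1) :
    fsDist p q = angle (spherePoint p) (spherePoint q) / 2 := by
  set t := ‖inner ℂ p.rep q.rep‖ / (‖p.rep‖ * ‖q.rep‖) with ht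
  have ht0 : 0 ≤ t := by positivity
  have ht1 : t ≤ 1 := div_le_one_of_le₀ (norm_inner_le_norm _ _) (by positivity)
  have hinner : inner ℝ (spherePoint p) (spherePoint q) = Real.cos (2 * Real.arccos t) := by
    have := one_add_inner_bloch p.rep_nonzero q.rep_nonzero
    rw [Real.cos_two_mul, Real.cos_arccos (by linarith) ht1, ht, div_pow, mul_pow, spherePoint,
      spherePoint]
    linarith
  have hpi : Real.arccos t ≤ Real.pi / 2 := Real.arccos_le_pi_div_two.2 ht0
  rw [angle, norm_spherePoint, norm_spherePoint, mul_one, div_one, hinner,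
    Real.arccos_cos (by linarith [Real.arccos_nonneg t]) (by linarith), fsDist]
  ring

theorem mem_openHemisphere_iff {c p : CP1} :
    p ∈ openHemisphere c ↔ 0 < inner ℝ (spherePoint c) (spherePoint p) := by
  rw [openHemisphere, mem_ofPred_eq, fsDist_eq_angle, ← Real.arccos_lt_pi_div_two,
    angle, norm_spherePoint, norm_spherePoint, mul_one, div_one]
  constructor <;> intro h <;> linarith

theorem mem_greatCircle_iff {c p : CP1} :
    p ∈ greatCircle c ↔ inner ℝ (spherePoint c) (spherePoint p) = 0 := by
  rw [greatCircle, mem_ofPred_eq, fsDist_eq_angle, inner_eq_zero_iff_angle_eq_pi_div_two]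
  constructor <;> intro h <;> linarith

theorem fsDist_eq_pi_div_two_iff {p q : CP1} :
    fsDist p q = Real.pi / 2 ↔ spherePoint p = -spherePoint q := by
  rw [fsDist_eq_angle, div_left_inj' two_ne_zero,
    ← inner_eq_neg_mul_norm_iff_angle_eq_pi (spherePoint_ne_zero _) (spherePoint_ne_zero _),
    norm_spherePoint, norm_spherePoint, mul_one, ← neg_eq_iff_eq_neg, ← inner_neg_right]
  exact inner_eq_one_iff_of_norm_eq_one (norm_spherePoint p) (by rw [norm_neg, norm_spherePoint])

theorem norm_spherePoint_sub_le (p q : CP1) : ‖spherePoint p - spherePoint q‖ ≤ 2 * fsDist p q := by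
  have hcos := Real.one_sub_sq_div_two_le_cos (x := angle (spherePoint p) (spherePoint q))
  rw [← inner_eq_cos_angle_of_norm_eq_one (norm_spherePoint p) (norm_spherePoint q)] at hcos
  have hsub := norm_sub_sq_real (spherePoint p) (spherePoint q)
  rw [norm_spherePoint, norm_spherePoint] at hsub
  rw [fsDist_eq_angle, mul_div_cancel₀ _ two_ne_zero]
  exact le_of_sq_le_sq (by linarith) (angle_nonneg _ _)

end BlochSphere

section GeodesicConvexity

theorem mem_geodSegment_iff {p q r : CP1} :
    r ∈ geodSegment p q ↔ angle (spherePoint p) (spherePoint q) = Real.pi ∨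
      spherePoint r ∈ Submodule.span ℝ≥0 {spherePoint p, spherePoint q} := by
  rw [← angle_eq_angle_add_angle_iff (spherePoint_ne_zero r), geodSegment, mem_ofPred_eq,
    fsDist_eq_angle, fsDist_eq_angle, fsDist_eq_angle]
  constructor <;> intro h <;> linarith

theorem geodConvex_preimage_cone {C : Submodule ℝ≥0 R3} {c : R3}
    (hC : ∀ x ∈ C, x ≠ 0 → 0 < inner ℝ c x) : GeodConvex (spherePoint ⁻¹' C) := by
  intro p hp q hq r hr
  rcases mem_geodSegment_iff.1 hr with hpi | hspan
  · obtain ⟨_, a, ha, heq⟩ := angle_eq_pi_iff.1 hpi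
    have hpos := hC _ hq (spherePoint_ne_zero q)
    rw [heq, inner_smul_right] at hpos
    exact absurd hpos (mul_neg_of_neg_of_pos ha (hC _ hp (spherePoint_ne_zero p))).not_gt
  · exact Submodule.span_le.2 (pair_subset hp hq) hspan

theorem GeodConvex.mem_of_mem_span_pair {K : Set CP1} (hK : GeodConvex K) {p q r : CP1}
    (hp : p ∈ K) (hq : q ∈ K)
    (hr : spherePoint r ∈ Submodule.span ℝ≥0 {spherePoint p, spherePoint q}) : r ∈ K :=
  hK p hp q hq (mem_geodSegment_iff.2 (Or.inr hr))

theorem GeodConvex.mem_of_mem_span_nnreal {K : Set CP1} (hK : GeodConvex K) {q : CP1}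
    (hq : spherePoint q ∈ Submodule.span ℝ≥0 (spherePoint '' K)) : q ∈ K := by
  have hray : ∀ x ∈ Submodule.span ℝ≥0 (spherePoint '' K),
      x = 0 ∨ ∃ p ∈ K, ∃ a : ℝ≥0, x = a • spherePoint p := by
    intro x hx
    induction hx using Submodule.span_induction with
    | mem _ hx =>
      obtain ⟨p, hp, rfl⟩ := hx
      exact Or.inr ⟨p, hp, 1, (one_smul _ _).symm⟩
    | zero => exact Or.inl rfl
    | add x y _ _ hx hy =>
      rcases hx with rfl | ⟨p, hp, a, rfl⟩
      · rwa [zero_add]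
      rcases hy with rfl | ⟨q, hq, b, rfl⟩
      · rw [add_zero]; exact Or.inr ⟨p, hp, a, rfl⟩
      refine or_iff_not_imp_left.2 fun hne => ?_
      obtain ⟨r, t, ht, hr⟩ := exists_eq_smul_spherePoint hne
      lift t to ℝ≥0 using ht.le
      rw [← NNReal.smul_def] at hr
      have hr' : spherePoint r = t⁻¹ • (a • spherePoint p + b • spherePoint q) := by
        rw [hr, inv_smul_smul₀ (NNReal.coe_pos.1 ht).ne']
      refine ⟨r, hK.mem_of_mem_span_pair hp hq (hr' ▸ Submodule.smul_mem _ _ ?_), t, hr⟩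
      exact Submodule.mem_span_pair.2 ⟨a, b, rfl⟩
    | smul b x _ hx =>
      rcases hx with rfl | ⟨p, hp, a, rfl⟩
      · exact Or.inl (smul_zero b)
      · exact Or.inr ⟨p, hp, b * a, (mul_smul _ _ _).symm⟩
  obtain h0 | ⟨p, hp, a, ha⟩ := hray _ hq
  · exact absurd h0 (spherePoint_ne_zero q)
  · refine hK.mem_of_mem_span_pair hp hp (ha ▸ Submodule.smul_mem _ a (Submodule.subset_span ?_))
    exact mem_insert _ _

theorem geodHull_eq_preimage_span {Z : Set CP1} {c : CP1} (hZ : Z ⊆ openHemisphere c) :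
    geodHull Z = spherePoint ⁻¹' Submodule.span ℝ≥0 (spherePoint '' Z) := by
  apply Subset.antisymm
  · refine sInter_subset_of_mem ⟨fun z hz => Submodule.subset_span (mem_image_of_mem _ hz),
      geodConvex_preimage_cone (c := spherePoint c) fun _ => inner_pos_of_mem_span_nnreal ?_⟩
    rintro _ ⟨z, hz, rfl⟩
    exact mem_openHemisphere_iff.1 (hZ hz)
  · rintro q hq K ⟨hZK, hK⟩
    exact hK.mem_of_mem_span_nnreal (Submodule.span_mono (image_mono hZK) hq)

theorem opposite_preimage_span {ι : Type*} {p : ι → R3} :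
    opposite (spherePoint ⁻¹' Submodule.span ℝ≥0 (range p)) =
      spherePoint ⁻¹' Submodule.span ℝ≥0 (range (-p)) := by
  ext q
  simp only [opposite, fsDist_eq_pi_div_two_iff, mem_preimage, SetLike.mem_coe,
    mem_span_nnreal_range_neg, mem_ofPred_eq]
  constructor
  · rintro ⟨r, hr, h⟩
    rwa [← h]
  · intro hq
    obtain ⟨r, hr⟩ := exists_spherePoint_eq (x := -spherePoint q)
      (by rw [norm_neg, norm_spherePoint])
    exact ⟨r, hr ▸ hq, hr⟩

theorem spherePoint_mem_span_of_mem_geodSpan {S : Set CP1} {r : CP1} (hr : r ∈ geodSpan S) :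
    spherePoint r ∈ Submodule.span ℝ (spherePoint '' S) := by
  rw [← Submodule.orthogonal_orthogonal (Submodule.span ℝ (spherePoint '' S)),
    Submodule.mem_orthogonal]
  intro x hx
  rcases eq_or_ne x 0 with rfl | hx0
  · exact inner_zero_left _
  obtain ⟨c, a, -, rfl⟩ := exists_eq_smul_spherePoint hx0
  have ha : a ≠ 0 := (smul_ne_zero_iff.1 hx0).1
  have hS : S ⊆ greatCircle c := fun q hq => mem_greatCircle_iff.2 <| by
    have := (Submodule.mem_orthogonal' _ _).1 hx _ (Submodule.subset_span (mem_image_of_mem _ hq))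
    rwa [real_inner_smul_left, mul_eq_zero, or_iff_right ha] at this
  rw [real_inner_smul_left, mem_greatCircle_iff.1 (hr c hS), mul_zero]

theorem preimage_openCone_subset_geodInterior {ι : Type*} [Fintype ι] {p : ι → R3} :
    spherePoint ⁻¹' openCone p ⊆
      geodInterior (spherePoint ⁻¹' Submodule.span ℝ≥0 (range p)) := by
  intro q hq
  obtain ⟨ε, hε, hball⟩ := Metric.mem_nhdsWithin_iff.1 (openCone_mem_nhdsWithin_span hq)
  refine ⟨openCone_subset_span_nnreal hq, ε / 2, half_pos hε, fun r hr hdist => ?_⟩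
  have hspan : Submodule.span ℝ (spherePoint '' (spherePoint ⁻¹' Submodule.span ℝ≥0 (range p))) ≤
      Submodule.span ℝ (range p) :=
    Submodule.span_le.2 ((image_preimage_subset _ _).trans (Submodule.span_subset_span ℝ≥0 ℝ _))
  refine openCone_subset_span_nnreal (hball ⟨?_, hspan (spherePoint_mem_span_of_mem_geodSpan hr)⟩)
  rw [mem_ball_iff_norm']
  linarith [norm_spherePoint_sub_le q r]

end GeodesicConvexity

section EntireFunctions

variable {f : ℂ → ℂ} {n k : ℕ} {C : ℝ}

theorem iteratedDeriv_zero_eq_zero_of_growth (hf : Differentiable ℂ f)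
    (hC : ∀ z : ℂ, 1 ≤ ‖z‖ → ‖f z‖ ≤ C * ‖z‖ ^ n) (hk : n < k) : iteratedDeriv k f 0 = 0 := by
  have hcauchy : ∀ R : ℝ, 1 ≤ R → ‖iteratedDeriv k f 0‖ ≤ k.factorial * C * (R ^ n / R ^ k) := by
    intro R hR
    refine (Complex.norm_iteratedDeriv_le_of_forall_mem_sphere_norm_le (C := C * R ^ n) k
      (zero_lt_one.trans_le hR) hf.diffContOnCl fun z hz => ?_).trans_eq (by ring)
    rw [mem_sphere_zero_iff_norm] at hz
    exact hz ▸ hC z (hz.symm ▸ hR)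
  have hlim :
      Filter.Tendsto (fun R : ℝ => k.factorial * C * (R ^ n / R ^ k)) Filter.atTop (𝓝 0) := by
    simpa using (tendsto_pow_div_pow_atTop_zero (𝕜 := ℝ) hk).const_mul (k.factorial * C)
  exact norm_le_zero_iff.1 (ge_of_tendsto hlim ((Filter.eventually_ge_atTop 1).mono hcauchy))

theorem exists_polynomial_of_growth (hf : Differentiable ℂ f)
    (hC : ∀ z : ℂ, 1 ≤ ‖z‖ → ‖f z‖ ≤ C * ‖z‖ ^ n) :
    ∃ q : Polynomial ℂ, q.natDegree ≤ n ∧ ∀ z, f z = q.eval z := by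
  refine ⟨∑ k ∈ Finset.range (n + 1),
    Polynomial.monomial k ((k.factorial : ℂ)⁻¹ * iteratedDeriv k f 0), ?_, fun z => ?_⟩
  · refine Polynomial.natDegree_sum_le_of_forall_le _ _ fun k hk => ?_
    exact (Polynomial.natDegree_monomial_le _).trans (Nat.lt_succ_iff.1 (Finset.mem_range.1 hk))
  · rw [← Complex.taylorSeries_eq_of_entire' 0 z hf, tsum_eq_sum (s := Finset.range (n + 1)),
      Polynomial.eval_finsetSum]
    · simp only [sub_zero, Polynomial.eval_monomial]
    · intro k hk
      rw [Finset.mem_range, Nat.lt_succ_iff, not_le] at hk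
      rw [iteratedDeriv_zero_eq_zero_of_growth hf hC hk, mul_zero, zero_mul]

end EntireFunctions

section Charts

variable {n : ℕ} {s t : HolSection n} {v : C2} {z : ℂ}

theorem exists_eq_smul_chartVec (hv : v ≠ 0) : ∃ a : ℂ, a ≠ 0 ∧ ∃ k z, v = a • chartVec k z := by
  by_cases h0 : v 0 = 0
  · have h1 : v 1 ≠ 0 := fun h1 => hv <| by
      ext k
      fin_cases k
      exacts [h0, h1]
    refine ⟨v 1, h1, 1, 0, ?_⟩
    ext k
    fin_cases k <;> simp [chartVec, h0]
  · refine ⟨v 0, h0, 0, v 1 / v 0, ?_⟩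
    ext k
    fin_cases k <;> simp [chartVec, mul_div_cancel₀, h0]

theorem exists_chart_eq (p : CP1) : ∃ k z, chart k z = p := by
  obtain ⟨a, ha, k, z, h⟩ := exists_eq_smul_chartVec p.rep_nonzero
  exact ⟨k, z, by
    rw [chart, ← p.mk_rep, Projectivization.mk_eq_mk_iff' ℂ _ _ _ p.rep_nonzero]
    exact ⟨a⁻¹, by rw [h, inv_smul_smul₀ ha]⟩⟩

theorem chartVec_zero_eq_smul (hz : z ≠ 0) : chartVec 0 z = z • chartVec 1 z⁻¹ := by
  ext k
  fin_cases k <;> simp [chartVec, hz]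

/-- The constant velocity of the lifted chart `chartVec k`. -/
def chartDir (k : Fin 2) : C2 := if k = 0 then !₂[0, 1] else !₂[1, 0]

theorem hasDerivAt_chartVec (k : Fin 2) (z : ℂ) : HasDerivAt (chartVec k) (chartDir k) z := by
  have hline : chartVec k = fun z => chartVec k 0 + z • chartDir k := by
    ext z j
    fin_cases k <;> fin_cases j <;> simp [chartVec, chartDir]
  rw [hline]
  simpa using ((hasDerivAt_id z).smul_const (chartDir k)).const_add (chartVec k 0)

namespace HolSection

theorem differentiableAt_toFun (s : HolSection n) (hv : v ≠ 0) :
    DifferentiableAt ℂ s.toFun v :=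
  s.holomorphic.differentiableAt (isOpen_compl_singleton.mem_nhds hv)

theorem hasDerivAt_coeff (s : HolSection n) (k : Fin 2) (z : ℂ) :
    HasDerivAt (s.coeff k) (fderiv ℂ s.toFun (chartVec k z) (chartDir k)) z :=
  (s.differentiableAt_toFun (chartVec_ne_zero k z)).hasFDerivAt.comp_hasDerivAt z
    (hasDerivAt_chartVec k z)

theorem differentiable_coeff (s : HolSection n) (k : Fin 2) : Differentiable ℂ (s.coeff k) :=
  fun z => (s.hasDerivAt_coeff k z).differentiableAt

theorem coeff_zero_eq (s : HolSection n) (hz : z ≠ 0) : s.coeff 0 z = z ^ n * s.coeff 1 z⁻¹ := by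
  rw [coeff, chartVec_zero_eq_smul hz, s.homogeneous _ _ hz (chartVec_ne_zero _ _), coeff]

theorem coeff_growth (s : HolSection n) :
    ∃ C : ℝ, ∀ z : ℂ, 1 ≤ ‖z‖ → ‖s.coeff 0 z‖ ≤ C * ‖z‖ ^ n := by
  obtain ⟨C, hC⟩ := (isCompact_closedBall (0 : ℂ) 1).exists_bound_of_continuousOn
    (s.differentiable_coeff 1).continuous.continuousOn
  refine ⟨C, fun z hz => ?_⟩
  rw [s.coeff_zero_eq (norm_pos_iff.1 (zero_lt_one.trans_le hz)), norm_mul, norm_pow, mul_comm]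
  gcongr
  refine hC _ (mem_closedBall_zero_iff.2 ?_)
  rw [norm_inv]
  exact inv_le_one_of_one_le₀ hz

theorem coeff_one_eq_of_coeff_zero_eq (h : s.coeff 0 = t.coeff 0) : s.coeff 1 = t.coeff 1 := by
  refine Continuous.ext_on (dense_compl_singleton (0 : ℂ)) (s.differentiable_coeff 1).continuous
    (t.differentiable_coeff 1).continuous fun z hz => ?_
  have hz' : z⁻¹ ≠ 0 := inv_ne_zero hz
  have := congrFun h z⁻¹
  rw [s.coeff_zero_eq hz', t.coeff_zero_eq hz', inv_inv] at this
  exact mul_left_cancel₀ (pow_ne_zero n hz') this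

theorem toFun_eq_of_coeff_zero_eq (h : s.coeff 0 = t.coeff 0) (hv : v ≠ 0) :
    s.toFun v = t.toFun v := by
  obtain ⟨a, ha, k, z, rfl⟩ := exists_eq_smul_chartVec hv
  rw [s.homogeneous _ _ ha (chartVec_ne_zero k z), t.homogeneous _ _ ha (chartVec_ne_zero k z)]
  congr 1
  fin_cases k
  exacts [congrFun h z, congrFun (coeff_one_eq_of_coeff_zero_eq h) z]

end HolSection

end Charts

section Factorization

variable {n : ℕ}

/-- The section of `𝒪(n)` which is `C` times the product of the linear forms `⟪b i, ·⟫`. -/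
def linearFormProd (C : ℂ) (b : Fin n → C2) : HolSection n where
  toFun v := C * ∏ i, inner ℂ (b i) v
  holomorphic := (Differentiable.const_mul (fun _ => (HasFDerivAt.finsetProd fun i _ =>
    (innerSL ℂ (b i)).hasFDerivAt).differentiableAt) C).differentiableOn
  homogeneous c v _ _ := by
    simp only [inner_smul_right, Finset.prod_mul_distrib, Finset.prod_const, Finset.card_univ,
      Fintype.card_fin]
    ring

/-- The section `s` is `C` times the product of the linear forms `⟪b i, ·⟫`, which are all
nonzero. -/
structure Factors (s : HolSection n) (C : ℂ) (b : Fin n → C2) : Prop where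
  const_ne_zero : C ≠ 0
  vec_ne_zero : ∀ i, b i ≠ 0
  toFun_eq : ∀ v ≠ 0, s.toFun v = C * ∏ i, inner ℂ (b i) v

theorem exists_fin_map_eq {α : Type*} {T : Multiset α} (hT : Multiset.card T = n) :
    ∃ b : Fin n → α, Finset.univ.val.map b = T := by
  subst hT
  induction T using Quotient.inductionOn with
  | h l => exact ⟨l.get, (Fin.univ_val_map l.get).trans (congrArg _ (List.ofFn_get l))⟩

theorem exists_prod_inner_chartVec_eq {S : Multiset ℂ} (hS : Multiset.card S ≤ n) :
    ∃ b : Fin n → C2, (∀ i, b i ≠ 0) ∧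
      ∀ z, ∏ i, inner ℂ (b i) (chartVec 0 z) = (S.map fun r => z - r).prod := by
  let u : ℂ → C2 := fun r => !₂[-(starRingEnd ℂ) r, 1]
  -- The linear form `⟪e, ·⟫` vanishes at infinity.
  let e : C2 := !₂[1, 0]
  have hu (r z : ℂ) : inner ℂ (u r) (chartVec 0 z) = z - r := by
    rw [inner_C2]
    simp [u, chartVec, neg_add_eq_sub]
  have he (z : ℂ) : inner ℂ e (chartVec 0 z) = 1 := by
    rw [inner_C2]
    simp [e, chartVec]
  obtain ⟨b, hb⟩ := exists_fin_map_eq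
    (T := S.map u + Multiset.replicate (n - Multiset.card S) e) (n := n) (by simp [hS])
  refine ⟨b, fun i hi => ?_, fun z => ?_⟩
  · have hmem : b i ∈ S.map u + Multiset.replicate (n - Multiset.card S) e :=
      hb ▸ Multiset.mem_map_of_mem b (Finset.mem_univ i)
    rw [hi] at hmem
    rcases Multiset.mem_add.1 hmem with h | h
    · obtain ⟨r, -, hr⟩ := Multiset.mem_map.1 h
      exact one_ne_zero (congrArg (fun v : C2 => v 1) hr)
    · exact zero_ne_one (congrArg (fun v : C2 => v 0) (Multiset.eq_of_mem_replicate h))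
  · have hprod := congrArg (fun T => (T.map fun v => inner ℂ v (chartVec 0 z)).prod) hb
    rw [Finset.prod_eq_multiset_prod]
    simpa only [Multiset.map_map, Multiset.map_add, Multiset.prod_add, Multiset.map_replicate,
      Multiset.prod_replicate, he, one_pow, mul_one, Function.comp_def, hu] using hprod

theorem exists_factors (s : HolSection n) (hs : s.IsNonzero) : ∃ C b, Factors s C b := by
  obtain ⟨A, hA⟩ := s.coeff_growth
  obtain ⟨q, hdeg, hq⟩ := exists_polynomial_of_growth (s.differentiable_coeff 0) hA
  obtain ⟨b, hb, hprod⟩ := exists_prod_inner_chartVec_eq (q.card_roots'.trans hdeg)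
  have hcoeff : s.coeff 0 = (linearFormProd q.leadingCoeff b).coeff 0 := by
    funext z
    rw [hq, (IsAlgClosed.splits q).eval_eq_prod_roots, ← hprod]
    rfl
  have hs_eq {v : C2} (hv : v ≠ 0) : s.toFun v = q.leadingCoeff * ∏ i, inner ℂ (b i) v :=
    HolSection.toFun_eq_of_coeff_zero_eq hcoeff hv
  obtain ⟨v, hv, hsv⟩ := hs
  exact ⟨q.leadingCoeff, b, left_ne_zero_of_mul (hs_eq hv ▸ hsv), hb, fun _ => hs_eq⟩

end Factorization

section TangentPlane

variable {v : C2} {y : R3}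

/-- The vector orthogonal to `v`, which represents a tangent direction of `ℂℙ¹` at `[v]`. -/
def perp (v : C2) : C2 := !₂[-(starRingEnd ℂ) (v 1), (starRingEnd ℂ) (v 0)]

/-- The projection of `ℝ³` to the tangent plane of the sphere at `bloch v`, the plane being
identified with `ℂ` up to a factor. -/
def tangentMap (v : C2) : R3 →ₗ[ℝ] ℂ where
  toFun y := y 0 * (-2 * (starRingEnd ℂ) (v 0) * (starRingEnd ℂ) (v 1)) +
    y 1 * ((starRingEnd ℂ) (v 0) ^ 2 - (starRingEnd ℂ) (v 1) ^ 2) -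
    y 2 * (Complex.I * ((starRingEnd ℂ) (v 0) ^ 2 + (starRingEnd ℂ) (v 1) ^ 2))
  map_add' x y := by simp only [PiLp.add_apply, Complex.ofReal_add]; ring
  map_smul' a y := by
    simp only [PiLp.smul_apply, smul_eq_mul, Complex.ofReal_mul, RingHom.id_apply,
      Complex.real_smul]
    ring

theorem tangentMap_bloch (v : C2) {u : C2} (hu : u ≠ 0) :
    tangentMap v (bloch u) = 2 * (inner ℂ v u * inner ℂ u (perp v)) / (‖u‖ ^ 2 : ℝ) := by
  have hu0 : ((‖u‖ ^ 2 : ℝ) : ℂ) ≠ 0 := by simpa using hu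
  rw [eq_div_iff hu0, bloch, map_smul, Complex.real_smul, Complex.ofReal_inv, mul_comm,
    mul_inv_cancel_left₀ hu0, inner_C2, inner_C2]
  apply Complex.ext <;> simp [tangentMap, perp, pow_two] <;> ring

theorem normSq_tangentMap (hv : v ≠ 0) :
    Complex.normSq (tangentMap v y) = ‖v‖ ^ 4 * (‖y‖ ^ 2 - inner ℝ (bloch v) y ^ 2) := by
  have hv0 : ‖v‖ ^ 2 ≠ 0 := by simpa using hv
  have h : ‖v‖ ^ 4 * (‖y‖ ^ 2 - inner ℝ (bloch v) y ^ 2) =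
      (‖v‖ ^ 2) ^ 2 * ‖y‖ ^ 2 - (‖v‖ ^ 2 * inner ℝ (bloch v) y) ^ 2 := by ring
  rw [h, bloch, real_inner_smul_left, mul_inv_cancel_left₀ hv0, norm_sq_C2,
    EuclideanSpace.norm_sq_eq, Fin.sum_univ_three, inner_R3, Complex.normSq_apply]
  simp only [tangentMap, LinearMap.coe_mk, AddHom.coe_mk, pow_two, Complex.sub_re, Complex.add_re,
    Complex.neg_re, Complex.mul_re, Complex.ofReal_re, Complex.re_ofNat, Complex.conj_re,
    Complex.I_re, Complex.sub_im, Complex.add_im, Complex.neg_im, Complex.mul_im,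
    Complex.ofReal_im, Complex.im_ofNat, Complex.conj_im, Complex.I_im, Real.norm_eq_abs,
    abs_mul_abs_self, Matrix.cons_val]
  ring

theorem tangentMap_eq_zero_iff (hv : v ≠ 0) : tangentMap v y = 0 ↔ ∃ a : ℝ, y = a • bloch v := by
  rw [← Complex.normSq_eq_zero, normSq_tangentMap hv, mul_eq_zero,
    or_iff_right (pow_ne_zero 4 (norm_ne_zero_iff.2 hv))]
  constructor
  · intro h
    refine ⟨inner ℝ (bloch v) y, ?_⟩
    rw [← sub_eq_zero, ← norm_eq_zero, ← sq_eq_zero_iff, norm_sub_sq_real, norm_smul,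
      norm_bloch hv, real_inner_smul_right, real_inner_comm, Real.norm_eq_abs, mul_one, sq_abs]
    rw [real_inner_comm] at h
    linarith
  · rintro ⟨a, rfl⟩
    rw [norm_smul, real_inner_smul_right, real_inner_self_eq_norm_sq, norm_bloch hv]
    simp

end TangentPlane

section CovariantDerivative

variable {n : ℕ} {v : C2}

theorem norm_chartVec_sq (k : Fin 2) (z : ℂ) : ‖chartVec k z‖ ^ 2 = 1 + ‖z‖ ^ 2 := by
  rw [EuclideanSpace.norm_sq_eq, Fin.sum_univ_two]
  fin_cases k <;> simp [chartVec, add_comm]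

theorem one_add_norm_sq_ne_zero (z : ℂ) : ((1 + ‖z‖ ^ 2 : ℝ) : ℂ) ≠ 0 :=
  Complex.ofReal_ne_zero.2 (by positivity)

theorem exists_chartDir_eq (k : Fin 2) (z : ℂ) : ∃ a : ℂ, a ≠ 0 ∧
    ((1 + ‖z‖ ^ 2 : ℝ) : ℂ) • chartDir k =
      (starRingEnd ℂ) z • chartVec k z + a • perp (chartVec k z) := by
  have h : (starRingEnd ℂ) z * z = ‖z‖ ^ 2 := Complex.conj_mul' z
  fin_cases k
  · refine ⟨1, one_ne_zero, ?_⟩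
    ext j
    fin_cases j <;> simp [chartDir, chartVec, perp, h, add_comm]
  · refine ⟨-1, neg_ne_zero.2 one_ne_zero, ?_⟩
    ext j
    fin_cases j <;> simp [chartDir, chartVec, perp, h, add_comm]

theorem wirtinger_potential (n : ℕ) (z : ℂ) :
    wirtinger (HolSection.potential n) z = n * (starRingEnd ℂ) z / ((1 + ‖z‖ ^ 2 : ℝ) : ℂ) := by
  have hlog : HasFDerivAt (fun w : ℂ => n * Real.log (1 + ‖w‖ ^ 2))
      ((n : ℝ) • ((1 + ‖z‖ ^ 2)⁻¹ • (2 • innerSL ℝ z))) z :=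
    (((hasStrictFDerivAt_norm_sq z).hasFDerivAt.const_add 1).log (by positivity)).const_mul (n : ℝ)
  have hpot : HasFDerivAt (HolSection.potential n) (Complex.ofRealCLM.comp
      ((n : ℝ) • ((1 + ‖z‖ ^ 2)⁻¹ • (2 • innerSL ℝ z)))) z :=
    Complex.ofRealCLM.hasFDerivAt.comp z hlog
  have hconj : (starRingEnd ℂ) z = z.re - Complex.I * z.im := by
    apply Complex.ext <;> simp
  have hre : inner ℝ z 1 = z.re := by simp [Complex.inner]
  have him : inner ℝ z Complex.I = z.im := by simp [Complex.inner]
  have hz := one_add_norm_sq_ne_zero z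
  rw [wirtinger, hpot.fderiv, hconj]
  simp only [ContinuousLinearMap.comp_apply, smul_apply, innerSL_apply_apply, hre, him,
    Complex.ofRealCLM_apply, smul_eq_mul, nsmul_eq_mul]
  push_cast at hz ⊢
  field_simp

namespace HolSection

variable {s : HolSection n}

theorem fderiv_toFun_self (s : HolSection n) (hv : v ≠ 0) :
    fderiv ℂ s.toFun v v = n * s.toFun v := by
  have hline : HasDerivAt (fun c : ℂ => c • v) v 1 := by
    simpa using (hasDerivAt_id (1 : ℂ)).smul_const v
  have hs : HasFDerivAt s.toFun (fderiv ℂ s.toFun v) ((1 : ℂ) • v) := by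
    rw [one_smul]
    exact (s.differentiableAt_toFun hv).hasFDerivAt
  have hpow : HasDerivAt (fun c : ℂ => c ^ n * s.toFun v) (n * s.toFun v) 1 := by
    simpa using (hasDerivAt_pow n (1 : ℂ)).mul_const (s.toFun v)
  refine (hs.comp_hasDerivAt 1 hline).unique (hpow.congr_of_eventuallyEq ?_)
  filter_upwards [isOpen_compl_singleton.mem_nhds (one_ne_zero (α := ℂ))] with c hc
  exact s.homogeneous c v hc hv

theorem covDeriv_eq (s : HolSection n) (k : Fin 2) (z h : ℂ) :
    s.covDeriv k z h = (deriv (s.coeff k) z -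
      s.coeff k z * (n * (starRingEnd ℂ) z / ((1 + ‖z‖ ^ 2 : ℝ) : ℂ))) * h := by
  have hf := ((s.differentiable_coeff k z).hasDerivAt.hasFDerivAt.restrictScalars ℝ).fderiv
  rw [covDeriv, hf, wirtinger_potential]
  simp only [ContinuousLinearMap.coe_restrictScalars', ContinuousLinearMap.toSpanSingleton_apply,
    smul_eq_mul]
  ring

theorem forall_covDeriv_eq_zero_iff {k : Fin 2} {z : ℂ} :
    (∀ h, s.covDeriv k z h = 0) ↔
      fderiv ℂ s.toFun (chartVec k z) (perp (chartVec k z)) = 0 := by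
  set D := fderiv ℂ s.toFun (chartVec k z)
  obtain ⟨a, ha, hdir⟩ := exists_chartDir_eq k z
  have hz := one_add_norm_sq_ne_zero z
  have hD : ((1 + ‖z‖ ^ 2 : ℝ) : ℂ) * D (chartDir k) =
      (starRingEnd ℂ) z * (n * s.coeff k z) + a * D (perp (chartVec k z)) := by
    have := congrArg D hdir
    rwa [map_add, map_smul, map_smul, map_smul, s.fderiv_toFun_self (chartVec_ne_zero k z)] at this
  have hcov (h : ℂ) : s.covDeriv k z h =
      a / ((1 + ‖z‖ ^ 2 : ℝ) : ℂ) * D (perp (chartVec k z)) * h := by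
    rw [covDeriv_eq, (s.hasDerivAt_coeff k z).deriv]
    field_simp
    linear_combination h * hD
  simp only [hcov, mul_eq_zero, div_eq_zero_iff, ha, hz, false_or]
  exact ⟨fun h => (h 1).resolve_right one_ne_zero, fun h _ => Or.inl h⟩

theorem mem_criticalSet_iff {q : CP1} :
    q ∈ s.criticalSet ↔ ∀ k z, chart k z = q →
      fderiv ℂ s.toFun (chartVec k z) (perp (chartVec k z)) = 0 :=
  forall₃_congr fun _ _ _ => forall_covDeriv_eq_zero_iff

theorem chart_mem_zeros_iff {k : Fin 2} {z : ℂ} : chart k z ∈ s.zeros ↔ s.coeff k z = 0 := by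
  have hv := chartVec_ne_zero k z
  obtain ⟨a, ha⟩ := Projectivization.exists_smul_eq_mk_rep ℂ (chartVec k z) hv
  rw [chart, zeros, mem_ofPred_eq, ← ha, Units.smul_def, s.homogeneous _ _ a.ne_zero hv, coeff,
    mul_eq_zero, or_iff_right (pow_ne_zero _ a.ne_zero)]

end HolSection

end CovariantDerivative

section FactoredSection

variable {n : ℕ} {s : HolSection n} {C : ℂ} {b : Fin n → C2} {v : C2} {q : CP1}

/-- The zeros of the linear forms `⟪b i, ·⟫`, as points of the unit sphere. -/
def root (b : Fin n → C2) (i : Fin n) : R3 := -bloch (b i)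

theorem spherePoint_chart (k : Fin 2) (z : ℂ) : spherePoint (chart k z) = bloch (chartVec k z) :=
  spherePoint_mk _ _

theorem one_sub_inner_root {i : Fin n} (hb : b i ≠ 0) (hv : v ≠ 0) :
    1 - inner ℝ (bloch v) (root b i) =
      2 / (‖b i‖ ^ 2 * ‖v‖ ^ 2) * ‖inner ℂ (b i) v‖ ^ 2 := by
  rw [root, inner_neg_right, sub_neg_eq_add, real_inner_comm, one_add_inner_bloch hb hv]
  ring

theorem inner_eq_zero_iff_bloch_eq_root {i : Fin n} (hb : b i ≠ 0) (hv : v ≠ 0) :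
    inner ℂ (b i) v = 0 ↔ bloch v = root b i := by
  have hroot : ‖root b i‖ = 1 := by rw [root, norm_neg, norm_bloch hb]
  rw [← inner_eq_one_iff_of_norm_eq_one (𝕜 := ℝ) (norm_bloch hv) hroot, eq_comm (b := (1 : ℝ)),
    ← sub_eq_zero (a := (1 : ℝ)), one_sub_inner_root hb hv]
  simp [hb, hv]

namespace Factors

theorem norm_root (hf : Factors s C b) (i : Fin n) : ‖root b i‖ = 1 := by
  rw [root, norm_neg, norm_bloch (hf.vec_ne_zero i)]

theorem mem_zeros_iff (hf : Factors s C b) : q ∈ s.zeros ↔ ∃ i, spherePoint q = root b i := by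
  rw [HolSection.zeros, mem_ofPred_eq, hf.toFun_eq _ q.rep_nonzero, mul_eq_zero,
    or_iff_right hf.const_ne_zero, Finset.prod_eq_zero_iff]
  simp only [Finset.mem_univ, true_and,
    inner_eq_zero_iff_bloch_eq_root (hf.vec_ne_zero _) q.rep_nonzero, spherePoint]

theorem exists_normSq_eq (hf : Factors s C b) :
    ∃ K : ℝ, 0 < K ∧ ∀ q, s.normSq q = K * chordProd (root b) (spherePoint q) := by
  have hb (i) : 0 < ‖b i‖ := norm_pos_iff.2 (hf.vec_ne_zero i)
  refine ⟨‖C‖ ^ 2 * ∏ i, (‖b i‖ ^ 2 / 2), ?_, fun q => ?_⟩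
  · have := norm_pos_iff.2 hf.const_ne_zero
    exact mul_pos (by positivity) (Finset.prod_pos fun i _ => by have := hb i; positivity)
  · have hq : ‖q.rep‖ ≠ 0 := norm_ne_zero_iff.2 q.rep_nonzero
    have hpow : ‖q.rep‖ ^ (2 * n) = ∏ _i : Fin n, ‖q.rep‖ ^ 2 := by simp [pow_mul]
    rw [HolSection.normSq, hf.toFun_eq _ q.rep_nonzero, chordProd, mul_assoc,
      ← Finset.prod_mul_distrib, norm_mul, norm_prod, mul_pow, ← Finset.prod_pow, mul_div_assoc,
      hpow, ← Finset.prod_div_distrib]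
    congr 1
    refine Finset.prod_congr rfl fun i _ => ?_
    rw [spherePoint, one_sub_inner_root (hf.vec_ne_zero i) q.rep_nonzero]
    have := (hb i).ne'
    field_simp

theorem fderiv_toFun (hf : Factors s C b) (hv : v ≠ 0) (u : C2) : fderiv ℂ s.toFun v u =
    C * ∑ i, (∏ j ∈ Finset.univ.erase i, inner ℂ (b j) v) * inner ℂ (b i) u := by
  have hprod := (HasFDerivAt.finsetProd (u := Finset.univ) fun i _ =>
    (innerSL ℂ (b i)).hasFDerivAt (x := v)).const_mul C
  have heq : s.toFun =ᶠ[𝓝 v] fun v => C * ∏ i, innerSL ℂ (b i) v :=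
    Filter.eventuallyEq_of_mem (isOpen_compl_singleton.mem_nhds hv) hf.toFun_eq
  rw [(hprod.congr_of_eventuallyEq heq).fderiv]
  simp

theorem tangentMap_chordWeight_smul_root (hf : Factors s C b) (hv : v ≠ 0) (i : Fin n) :
    tangentMap v (chordWeight (root b) (bloch v) i • root b i) =
      -((‖v‖ ^ 2 * ∏ j, 2 / (‖b j‖ ^ 2 * ‖v‖ ^ 2) : ℝ) *
          (starRingEnd ℂ) (∏ j, inner ℂ (b j) v)) *
        ((∏ j ∈ Finset.univ.erase i, inner ℂ (b j) v) * inner ℂ (b i) (perp v)) := by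
  have hweight : (chordWeight (root b) (bloch v) i : ℂ) =
      (∏ j ∈ Finset.univ.erase i, 2 / (‖b j‖ ^ 2 * ‖v‖ ^ 2) : ℝ) *
        ((starRingEnd ℂ) (∏ j ∈ Finset.univ.erase i, inner ℂ (b j) v) *
          ∏ j ∈ Finset.univ.erase i, inner ℂ (b j) v) := by
    rw [Complex.conj_mul', norm_prod, ← Complex.ofReal_pow, ← Finset.prod_pow,
      ← Complex.ofReal_mul, ← Finset.prod_mul_distrib, chordWeight]
    simp only [one_sub_inner_root (hf.vec_ne_zero _) hv]
  have hb0 : (‖b i‖ : ℂ) ≠ 0 := Complex.ofReal_ne_zero.2 (norm_ne_zero_iff.2 (hf.vec_ne_zero i))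
  have hv0 : (‖v‖ : ℂ) ≠ 0 := Complex.ofReal_ne_zero.2 (norm_ne_zero_iff.2 hv)
  rw [map_smul, Complex.real_smul, hweight, root, map_neg, tangentMap_bloch v (hf.vec_ne_zero i),
    ← inner_conj_symm v, ← Finset.mul_prod_erase _ _ (Finset.mem_univ i),
    ← Finset.mul_prod_erase _ (fun j => inner ℂ (b j) v) (Finset.mem_univ i), map_mul]
  generalize ∏ j ∈ Finset.univ.erase i, 2 / (‖b j‖ ^ 2 * ‖v‖ ^ 2) = κ
  push_cast
  field_simp

theorem tangentMap_descentField (hf : Factors s C b) (hv : v ≠ 0) :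
    C * tangentMap v (descentField (root b) (bloch v)) =
      -((‖v‖ ^ 2 * ∏ j, 2 / (‖b j‖ ^ 2 * ‖v‖ ^ 2) : ℝ) *
        (starRingEnd ℂ) (∏ j, inner ℂ (b j) v)) * fderiv ℂ s.toFun v (perp v) := by
  rw [descentField, map_sum, hf.fderiv_toFun hv,
    Finset.sum_congr rfl fun i _ => hf.tangentMap_chordWeight_smul_root hv i, ← Finset.mul_sum]
  ring

theorem fderiv_perp_eq_zero_iff (hf : Factors s C b) (hv : v ≠ 0) (hsv : s.toFun v ≠ 0) :
    fderiv ℂ s.toFun v (perp v) = 0 ↔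
      ∃ a : ℝ, descentField (root b) (bloch v) = a • bloch v := by
  have hprod : ∏ j, inner ℂ (b j) v ≠ 0 := right_ne_zero_of_mul (hf.toFun_eq v hv ▸ hsv)
  have hnorm : ‖v‖ ^ 2 * ∏ j, 2 / (‖b j‖ ^ 2 * ‖v‖ ^ 2) ≠ 0 :=
    mul_ne_zero (pow_ne_zero 2 (norm_ne_zero_iff.2 hv)) <| Finset.prod_ne_zero_iff.2 fun j _ => by
      simp [hv, hf.vec_ne_zero j]
  have hfactor := neg_ne_zero.2
    (mul_ne_zero (Complex.ofReal_ne_zero.2 hnorm) ((map_ne_zero (starRingEnd ℂ)).2 hprod))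
  rw [← tangentMap_eq_zero_iff hv, ← mul_eq_zero_iff_left (b := fderiv _ _ _ _) hfactor,
    ← hf.tangentMap_descentField hv, mul_eq_zero_iff_left hf.const_ne_zero]

theorem mem_criticalSet_iff (hf : Factors s C b) (hq : q ∉ s.zeros) :
    q ∈ s.criticalSet ↔ ∃ a : ℝ, descentField (root b) (spherePoint q) = a • spherePoint q := by
  have hchart (k z) (h : chart k z = q) :
      fderiv ℂ s.toFun (chartVec k z) (perp (chartVec k z)) = 0 ↔
        ∃ a : ℝ, descentField (root b) (spherePoint q) = a • spherePoint q := by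
    subst h
    rw [spherePoint_chart]
    exact hf.fderiv_perp_eq_zero_iff (chartVec_ne_zero k z)
      (mt HolSection.chart_mem_zeros_iff.2 hq)
  rw [HolSection.mem_criticalSet_iff]
  constructor
  · intro h
    obtain ⟨k, z, hz⟩ := exists_chart_eq q
    exact (hchart k z hz).1 (h k z hz)
  · exact fun h k z hz => (hchart k z hz).2 h

theorem mem_criticalSet_of_root_eq (hf : Factors s C b) {i j : Fin n} (hij : i ≠ j)
    (hi : spherePoint q = root b i) (hj : spherePoint q = root b j) : q ∈ s.criticalSet := by
  refine HolSection.mem_criticalSet_iff.2 fun k z h => ?_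
  subst h
  have hv := chartVec_ne_zero k z
  rw [spherePoint_chart] at hi hj
  have hi0 := (inner_eq_zero_iff_bloch_eq_root (hf.vec_ne_zero i) hv).2 hi
  have hj0 := (inner_eq_zero_iff_bloch_eq_root (hf.vec_ne_zero j) hv).2 hj
  rw [hf.fderiv_toFun hv, Finset.sum_eq_zero, mul_zero]
  intro l _
  rcases eq_or_ne l i with rfl | hl
  · exact mul_eq_zero_of_left (Finset.prod_eq_zero (Finset.mem_erase.2 ⟨hij.symm, by simp⟩) hj0) _
  · exact mul_eq_zero_of_left (Finset.prod_eq_zero (Finset.mem_erase.2 ⟨hl.symm, by simp⟩) hi0) _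

end Factors

end FactoredSection

section SecondOrder

theorem deriv_deriv_nonpos_of_isLocalMax {f : ℝ → ℝ} {x : ℝ} (hf : ContinuousAt f x)
    (hmax : IsLocalMax f x) : deriv (deriv f) x ≤ 0 := by
  by_contra! hpos
  have hmin := isLocalMin_of_deriv_deriv_pos hpos hmax.deriv_eq_zero hf
  have hconst : f =ᶠ[𝓝 x] fun _ => f x := by
    filter_upwards [hmax, hmin] with y h₁ h₂ using le_antisymm h₁ h₂
  have hzero : deriv (deriv f) x = 0 := by
    rw [hconst.deriv.deriv_eq]
    simp
  exact hpos.ne' hzero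

variable {E : Type*} [NormedAddCommGroup E] [NormedSpace ℝ E]

theorem deriv_deriv_comp_line {f : E → ℝ} {z : E} (hf : ContDiffAt ℝ 2 f z) (v : E) :
    deriv (deriv fun t : ℝ => f (z + t • v)) 0 = fderiv ℝ (fderiv ℝ f) z v v := by
  have hline (t : ℝ) : HasDerivAt (fun t : ℝ => z + t • v) v t := by
    simpa using ((hasDerivAt_id t).smul_const v).const_add z
  have hline0 : z + (0 : ℝ) • v = z := by rw [zero_smul, add_zero]
  have hdiff : ∀ᶠ y in 𝓝 (z + (0 : ℝ) • v), DifferentiableAt ℝ f y := by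
    rw [hline0]
    exact (hf.eventually (by simp)).mono fun y hy => hy.differentiableAt two_ne_zero
  have hfirst : (deriv fun t : ℝ => f (z + t • v)) =ᶠ[𝓝 0] fun t => fderiv ℝ f (z + t • v) v := by
    filter_upwards [(hline 0).continuousAt.tendsto.eventually hdiff] with t ht
    exact (ht.hasFDerivAt.comp_hasDerivAt t (hline t)).deriv
  have hsecond : HasFDerivAt (fderiv ℝ f) (fderiv ℝ (fderiv ℝ f) z) (z + (0 : ℝ) • v) := by
    rw [hline0]
    exact ((hf.fderiv_right (m := 1) (by norm_num)).differentiableAt one_ne_zero).hasFDerivAt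
  rw [hfirst.deriv_eq]
  exact ((ContinuousLinearMap.apply ℝ ℝ v).hasFDerivAt.comp_hasDerivAt 0
    (hsecond.comp_hasDerivAt 0 (hline 0))).deriv

theorem fderiv_fderiv_nonpos_of_isLocalMax {f : E → ℝ} {z : E} (hf : ContDiffAt ℝ 2 f z)
    (hmax : IsLocalMax f z) (v : E) : fderiv ℝ (fderiv ℝ f) z v v ≤ 0 := by
  have hline : ContinuousAt (fun t : ℝ => z + t • v) 0 := by fun_prop
  have hline0 : z = z + (0 : ℝ) • v := by rw [zero_smul, add_zero]
  rw [← deriv_deriv_comp_line hf]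
  refine deriv_deriv_nonpos_of_isLocalMax ?_ ?_
  · exact ContinuousAt.comp (g := f) (hline0 ▸ hf.continuousAt) hline
  · exact IsLocalMax.comp_continuous (g := fun t : ℝ => z + t • v) (hline0 ▸ hmax) hline

theorem neg_of_nonpos_of_exists_ne_zero {H : E →L[ℝ] E →L[ℝ] ℝ} (hsymm : ∀ v w, H v w = H w v)
    (hle : ∀ v, H v v ≤ 0) {v : E} (hv : ∃ w, H v w ≠ 0) : H v v < 0 := by
  refine (hle v).lt_of_ne fun h => ?_
  obtain ⟨w, hw⟩ := hv
  have hker := ((-H).toBilinForm.apply_apply_same_eq_zero_iff (fun v => neg_nonneg.2 (hle v))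
    ⟨fun v w => congrArg Neg.neg (hsymm v w)⟩).1 (neg_eq_zero.2 h)
  exact hw (neg_eq_zero.1 (LinearMap.congr_fun hker w))

theorem hasMorseIndex_two_of_isLocalMax {u : CP1 → ℝ} {q : CP1}
    (hu : ∀ k z, chart k z = q → ContDiffAt ℝ 2 (fun w => u (chart k w)) z)
    (hmax : ∀ k z, chart k z = q → IsLocalMax (fun w => u (chart k w)) z)
    (hnd : IsNondegenerateAt u q) : HasMorseIndex u q 2 := by
  intro k z hz
  have hneg (v : ℂ) (hv : v ≠ 0) : hessian u k z v v < 0 :=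
    neg_of_nonpos_of_exists_ne_zero (fun v w => (hu k z hz).isSymmSndFDerivAt (by simp) v w)
      (fderiv_fderiv_nonpos_of_isLocalMax (hu k z hz) (hmax k z hz)) (hnd k z hz v hv)
  refine ⟨⟨⊤, by simp, fun v _ hv => hneg v hv⟩, ?_⟩
  rintro d ⟨W, rfl, -⟩
  exact (Submodule.finrank_le W).trans (by simp)

variable {F G H : Type*} [NormedAddCommGroup F] [NormedSpace ℝ F] [NormedAddCommGroup G]
  [NormedSpace ℝ G] [NormedAddCommGroup H] [NormedSpace ℝ H]

theorem fderiv_fderiv_bilinear_eq_zero (B : F →L[ℝ] G →L[ℝ] H) {f : E → F} {g : E → G} {z : E}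
    (hf : ContDiff ℝ 2 f) (hg : ContDiff ℝ 2 g) (hfz : f z = 0) (hgz : g z = 0)
    (hf' : fderiv ℝ f z = 0) (hg' : fderiv ℝ g z = 0) :
    fderiv ℝ (fderiv ℝ fun w => B (f w) (g w)) z = 0 := by
  have hfd (w : E) := hf.differentiable two_ne_zero w
  have hgd (w : E) := hg.differentiable two_ne_zero w
  have hfd' : DifferentiableAt ℝ (fderiv ℝ f) z :=
    (hf.fderiv_right (m := 1) (by norm_num)).differentiable one_ne_zero z
  have hgd' : DifferentiableAt ℝ (fderiv ℝ g) z :=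
    (hg.fderiv_right (m := 1) (by norm_num)).differentiable one_ne_zero z
  have hfderiv : (fderiv ℝ fun w => B (f w) (g w)) = fun w =>
      B.precompR E (f w) (fderiv ℝ g w) + B.precompL E (fderiv ℝ f w) (g w) :=
    funext fun w => B.fderiv_of_bilinear (hfd w) (hgd w)
  have h₁ := (B.precompR E).hasFDerivAt_of_bilinear (hfd z).hasFDerivAt hgd'.hasFDerivAt
  have h₂ := (B.precompL E).hasFDerivAt_of_bilinear hfd'.hasFDerivAt (hgd z).hasFDerivAt
  rw [hfderiv, (h₁.fun_add h₂).fderiv, hfz, hgz, hf', hg']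
  simp only [map_zero, zero_apply, add_zero]

end SecondOrder

section SectionNorm

namespace HolSection

variable {n : ℕ} {s : HolSection n} {k : Fin 2} {z : ℂ} {q : CP1}

theorem normSq_chart (s : HolSection n) (k : Fin 2) (z : ℂ) :
    s.normSq (chart k z) = ‖s.coeff k z‖ ^ 2 / (1 + ‖z‖ ^ 2) ^ n := by
  rw [chart, normSq_mk, pow_mul, norm_chartVec_sq, coeff]

theorem contDiff_coeff (s : HolSection n) (k : Fin 2) : ContDiff ℝ 2 (s.coeff k) :=
  (s.differentiable_coeff k).contDiff.restrict_scalars ℝ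

theorem contDiff_inv_one_add_norm_sq_pow (n : ℕ) :
    ContDiff ℝ 2 fun z : ℂ => ((1 + ‖z‖ ^ 2) ^ n)⁻¹ :=
  ((contDiff_const.add (contDiff_norm_sq ℝ)).pow n).inv fun z => by positivity

theorem contDiffAt_logNormSq (hz : s.coeff k z ≠ 0) :
    ContDiffAt ℝ 2 (fun w => s.logNormSq (chart k w)) z := by
  simp only [logNormSq, normSq_chart]
  refine ContDiffAt.log ?_ (by positivity)
  exact (((s.contDiff_coeff k).norm_sq ℝ).mul (contDiff_inv_one_add_norm_sq_pow n)).contDiffAt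

theorem isLocalMax_logNormSq_chart (hz : s.coeff k z ≠ 0)
    (hmax : ∀ q, s.normSq q ≤ s.normSq (chart k z)) :
    IsLocalMax (fun w => s.logNormSq (chart k w)) z := by
  filter_upwards [(s.contDiff_coeff k).continuous.continuousAt.eventually_ne hz] with w hw
  refine Real.log_le_log ?_ (hmax _)
  rw [normSq_chart]
  positivity

theorem hasMorseIndex_logNormSq (hq : q ∉ s.zeros) (hmax : ∀ r, s.normSq r ≤ s.normSq q)
    (hnd : IsNondegenerateAt s.logNormSq q) : HasMorseIndex s.logNormSq q 2 := by
  refine hasMorseIndex_two_of_isLocalMax ?_ ?_ hnd <;> rintro k z rfl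
  · exact contDiffAt_logNormSq (mt chart_mem_zeros_iff.2 hq)
  · exact isLocalMax_logNormSq_chart (mt chart_mem_zeros_iff.2 hq) hmax

theorem normSq_chart_eq_inner (s : HolSection n) (k : Fin 2) :
    (fun w => s.normSq (chart k w)) = fun w =>
      innerSL ℝ (s.coeff k w) (((1 + ‖w‖ ^ 2) ^ n)⁻¹ • s.coeff k w) := by
  funext w
  rw [innerSL_apply_apply, real_inner_smul_right, real_inner_self_eq_norm_sq, normSq_chart,
    div_eq_inv_mul]

theorem fderiv_normSq_chart_eq_zero (hz : s.coeff k z = 0) :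
    fderiv ℝ (fun w => s.normSq (chart k w)) z = 0 := by
  refine IsLocalMin.fderiv_eq_zero (Filter.Eventually.of_forall fun w => ?_)
  simp only [normSq_chart, hz, norm_zero, zero_pow two_ne_zero, zero_div]
  positivity

theorem hessian_normSq_eq_zero (hz : s.coeff k z = 0) (hz' : deriv (s.coeff k) z = 0) :
    hessian s.normSq k z = 0 := by
  have hcoeff := s.contDiff_coeff k
  have hmetric := contDiff_inv_one_add_norm_sq_pow n
  have hfderiv : fderiv ℝ (s.coeff k) z = 0 := by
    have := (s.differentiable_coeff k z).hasDerivAt.hasFDerivAt.restrictScalars ℝ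
    rw [this.fderiv, hz']
    ext
    simp
  rw [hessian, normSq_chart_eq_inner]
  refine fderiv_fderiv_bilinear_eq_zero _ hcoeff (hmetric.smul hcoeff) hz (by rw [hz, smul_zero])
    hfderiv ?_
  rw [fderiv_fun_smul (hmetric.differentiable two_ne_zero z)
    (hcoeff.differentiable two_ne_zero z), hfderiv, hz]
  simp

theorem notMem_criticalSet_of_mem_zeros
    (hnd : ∀ p, IsCriticalPt s.normSq p → IsNondegenerateAt s.normSq p)
    (hq : q ∈ s.zeros) : q ∉ s.criticalSet := by
  intro hcrit
  have hcoeff (k z) (h : chart k z = q) : s.coeff k z = 0 := chart_mem_zeros_iff.1 (h ▸ hq)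
  obtain ⟨k, z, h⟩ := exists_chart_eq q
  have hderiv : deriv (s.coeff k) z = 0 := by
    have := hcrit k z h 1
    rwa [covDeriv_eq, hcoeff k z h, zero_mul, sub_zero, mul_one] at this
  have hcritical : IsCriticalPt s.normSq q := fun k z h =>
    fderiv_normSq_chart_eq_zero (hcoeff k z h)
  obtain ⟨w, hw⟩ := hnd q hcritical k z h 1 one_ne_zero
  rw [hessian_normSq_eq_zero (hcoeff k z h) hderiv] at hw
  exact hw rfl

end HolSection

end SectionNorm

section CriticalPoints

variable {n : ℕ} {s : HolSection n} {C : ℂ} {b : Fin n → C2} {c q : CP1}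

theorem zeros_subset_hull (s : HolSection n) : s.zeros ⊆ s.hull :=
  subset_sInter fun _ hK => hK.1

theorem notMem_zeros_of_inner_nonpos (hc : s.zeros ⊆ openHemisphere c)
    (hq : inner ℝ (spherePoint c) (spherePoint q) ≤ 0) : q ∉ s.zeros :=
  fun h => hq.not_gt (mem_openHemisphere_iff.1 (hc h))

namespace Factors

theorem image_spherePoint_zeros (hf : Factors s C b) : spherePoint '' s.zeros = range (root b) := by
  ext x
  constructor
  · rintro ⟨q, hq, rfl⟩
    obtain ⟨i, hi⟩ := hf.mem_zeros_iff.1 hq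
    exact ⟨i, hi.symm⟩
  · rintro ⟨i, rfl⟩
    obtain ⟨q, hq⟩ := exists_spherePoint_eq (hf.norm_root i)
    exact ⟨q, hf.mem_zeros_iff.2 ⟨i, hq⟩, hq⟩

theorem inner_root_pos (hf : Factors s C b) (hc : s.zeros ⊆ openHemisphere c) (i : Fin n) :
    0 < inner ℝ (spherePoint c) (root b i) := by
  obtain ⟨q, hq, hqi⟩ := hf.image_spherePoint_zeros.superset (mem_range_self i)
  exact hqi ▸ mem_openHemisphere_iff.1 (hc hq)

theorem hull_eq (hf : Factors s C b) (hc : s.zeros ⊆ openHemisphere c) :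
    s.hull = spherePoint ⁻¹' Submodule.span ℝ≥0 (range (root b)) := by
  rw [HolSection.hull, geodHull_eq_preimage_span hc, hf.image_spherePoint_zeros]

theorem opposite_hull_eq (hf : Factors s C b) (hc : s.zeros ⊆ openHemisphere c) :
    opposite s.hull = spherePoint ⁻¹' Submodule.span ℝ≥0 (range (-root b)) := by
  rw [hf.hull_eq hc, opposite_preimage_span]

theorem inner_pos_of_mem_hull (hf : Factors s C b) (hc : s.zeros ⊆ openHemisphere c)
    (hq : q ∈ s.hull) : 0 < inner ℝ (spherePoint c) (spherePoint q) := by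
  rw [hf.hull_eq hc] at hq
  exact inner_pos_of_mem_span_nnreal (forall_mem_range.2 (hf.inner_root_pos hc)) hq
    (spherePoint_ne_zero q)

theorem inner_neg_of_mem_opposite_hull (hf : Factors s C b) (hc : s.zeros ⊆ openHemisphere c)
    (hq : q ∈ opposite s.hull) : inner ℝ (spherePoint c) (spherePoint q) < 0 := by
  obtain ⟨p, hp, hpq⟩ := hq
  have := hf.inner_pos_of_mem_hull hc hp
  rwa [fsDist_eq_pi_div_two_iff.1 hpq, inner_neg_right, neg_pos] at this

theorem mem_openCone_or_mem_openCone_neg [NeZero n] (hf : Factors s C b)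
    (hc : s.zeros ⊆ openHemisphere c) (hq : q ∈ s.criticalSet) (hqz : q ∉ s.zeros) :
    spherePoint q ∈ openCone (root b) ∨ spherePoint q ∈ openCone (-root b) := by
  obtain ⟨a, ha⟩ := (hf.mem_criticalSet_iff hqz).1 hq
  rw [mem_openCone_neg]
  exact mem_openCone_or_neg_mem_of_descentField_eq_smul hf.norm_root (hf.inner_root_pos hc)
    (norm_spherePoint q) (fun i hi => hqz (hf.mem_zeros_iff.2 ⟨i, hi⟩)) ha

theorem mem_geodInterior_or_mem_geodInterior_opposite [NeZero n] (hf : Factors s C b)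
    (hc : s.zeros ⊆ openHemisphere c) (hq : q ∈ s.criticalSet) (hqz : q ∉ s.zeros) :
    q ∈ geodInterior s.hull ∨ q ∈ geodInterior (opposite s.hull) := by
  rw [hf.opposite_hull_eq hc, hf.hull_eq hc]
  exact (hf.mem_openCone_or_mem_openCone_neg hc hq hqz).imp
    (fun h => preimage_openCone_subset_geodInterior h)
    fun h => preimage_openCone_subset_geodInterior h

theorem criticalSet_subset [NeZero n] (hf : Factors s C b) (hc : s.zeros ⊆ openHemisphere c) :
    s.criticalSet ⊆ s.hull ∪ opposite s.hull := by
  intro q hq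
  by_cases hqz : q ∈ s.zeros
  · exact Or.inl (zeros_subset_hull s hqz)
  · exact (hf.mem_geodInterior_or_mem_geodInterior_opposite hc hq hqz).imp And.left And.left

theorem criticalSet_inter_opposite_hull_subset [NeZero n] (hf : Factors s C b)
    (hc : s.zeros ⊆ openHemisphere c) :
    s.criticalSet ∩ opposite s.hull ⊆ geodInterior (opposite s.hull) := by
  rintro q ⟨hq, hqo⟩
  have hneg := hf.inner_neg_of_mem_opposite_hull hc hqo
  have hqz := notMem_zeros_of_inner_nonpos hc hneg.le
  exact (hf.mem_geodInterior_or_mem_geodInterior_opposite hc hq hqz).resolve_left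
    fun h => hneg.not_gt (hf.inner_pos_of_mem_hull hc h.1)

theorem criticalSet_inter_hull_diff_zeros_subset [NeZero n] (hf : Factors s C b)
    (hc : s.zeros ⊆ openHemisphere c) :
    (s.criticalSet ∩ s.hull) \ s.zeros ⊆ geodInterior s.hull := by
  rintro q ⟨⟨hq, hqh⟩, hqz⟩
  have hpos := hf.inner_pos_of_mem_hull hc hqh
  exact (hf.mem_geodInterior_or_mem_geodInterior_opposite hc hq hqz).resolve_right
    fun h => hpos.not_gt (hf.inner_neg_of_mem_opposite_hull hc h.1)

theorem criticalSet_inter_hull_nonempty (hf : Factors s C b) (hc : s.zeros ⊆ openHemisphere c)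
    (hn : 2 ≤ n) : (s.criticalSet ∩ s.hull).Nonempty := by
  have : Nontrivial (Fin n) := Fin.nontrivial_iff_two_le.2 hn
  by_cases hinj : Function.Injective (root b)
  · obtain ⟨x, hx, hxroot, ha⟩ :=
      exists_equilibrium_mem_sphericalHull hf.norm_root hinj (hf.inner_root_pos hc)
    have hnorm := norm_eq_one_of_mem_sphericalHull (hf.inner_root_pos hc) hx
    obtain ⟨q, rfl⟩ := exists_spherePoint_eq hnorm
    have hqz : q ∉ s.zeros := fun h => (hf.mem_zeros_iff.1 h).elim hxroot
    refine ⟨q, (hf.mem_criticalSet_iff hqz).2 ha, ?_⟩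
    rw [hf.hull_eq hc]
    exact sphericalHull_subset_span_nnreal hx
  · obtain ⟨i, j, hij, hne⟩ := Function.not_injective_iff.1 hinj
    obtain ⟨q, hq⟩ := exists_spherePoint_eq (hf.norm_root i)
    exact ⟨q, hf.mem_criticalSet_of_root_eq hne hq (hq.trans hij),
      zeros_subset_hull s (hf.mem_zeros_iff.2 ⟨i, hq⟩)⟩

theorem exists_forall_normSq_le [NeZero n] (hf : Factors s C b)
    (hc : s.zeros ⊆ openHemisphere c) :
    ∃ q ∈ s.criticalSet ∩ opposite s.hull, ∀ r, s.normSq r ≤ s.normSq q := by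
  obtain ⟨x, hx, hmax, hcx⟩ := exists_isMaxOn_chordProd hf.norm_root (hf.inner_root_pos hc)
  obtain ⟨q, rfl⟩ := exists_spherePoint_eq hx
  have hcrit : q ∈ s.criticalSet :=
    (hf.mem_criticalSet_iff (notMem_zeros_of_inner_nonpos hc hcx)).2
      (exists_descentField_eq_smul_of_isMaxOn hx hmax)
  have hopp : q ∈ opposite s.hull :=
    (hf.criticalSet_subset hc hcrit).resolve_left
      fun h => hcx.not_gt (hf.inner_pos_of_mem_hull hc h)
  obtain ⟨K, hK, hnormSq⟩ := hf.exists_normSq_eq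
  refine ⟨q, ⟨hcrit, hopp⟩, fun r => ?_⟩
  rw [hnormSq, hnormSq]
  exact mul_le_mul_of_nonneg_left (hmax (mem_sphere_zero_iff_norm.2 (norm_spherePoint r))) hK.le

theorem isLocalMaxAt_logNormSq (hf : Factors s C b) (hq : q ∉ s.zeros)
    (hmax : ∀ r, s.normSq r ≤ s.normSq q) : IsLocalMaxAt s.logNormSq q := by
  have hpos : 0 < chordProd (root b) (spherePoint q) :=
    (chordProd_nonneg hf.norm_root (norm_spherePoint q)).lt_of_ne'
      (mt (chordProd_eq_zero_iff hf.norm_root (norm_spherePoint q)).1 (mt hf.mem_zeros_iff.2 hq))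
  obtain ⟨ε, hε, hnear⟩ := Metric.eventually_nhds_iff.1
    (continuous_chordProd.continuousAt.eventually (lt_mem_nhds hpos))
  obtain ⟨K, hK, hnormSq⟩ := hf.exists_normSq_eq
  refine ⟨ε / 2, half_pos hε, fun r hr => Real.log_le_log ?_ (hmax r)⟩
  rw [hnormSq]
  refine mul_pos hK (hnear ?_)
  rw [dist_comm, dist_eq_norm]
  linarith [norm_spherePoint_sub_le q r]

end Factors

end CriticalPoints

end SphericalGL

end

theorem theorem1p3_general (n : ℕ) (hn : n ≠ 0) (s : SphericalGL.HolSection n) (hs : s.IsNonzero)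
    (hZ : ∃ c : SphericalGL.CP1, s.zeros ⊆ SphericalGL.openHemisphere c) :
    s.criticalSet =
        (s.criticalSet ∩ s.hull) ∪ (s.criticalSet ∩ SphericalGL.opposite s.hull) ∧
    s.criticalSet ∩ SphericalGL.opposite s.hull ⊆
      SphericalGL.geodInterior (SphericalGL.opposite s.hull) ∧
    (∃ q ∈ s.criticalSet ∩ SphericalGL.opposite s.hull,
      q ∉ s.zeros ∧ (∀ r, s.normSq r ≤ s.normSq q) ∧ SphericalGL.IsLocalMaxAt s.logNormSq q ∧
      (SphericalGL.IsNondegenerateAt s.logNormSq q →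
        SphericalGL.HasMorseIndex s.logNormSq q 2)) ∧
    (2 ≤ n → (s.criticalSet ∩ s.hull).Nonempty) ∧
    (s.criticalSet ∩ s.hull) \ s.zeros ⊆ SphericalGL.geodInterior s.hull := by
  have : NeZero n := ⟨hn⟩
  obtain ⟨c, hc⟩ := hZ
  obtain ⟨C, b, hf⟩ := SphericalGL.exists_factors s hs
  obtain ⟨q, hq, hmax⟩ := hf.exists_forall_normSq_le hc
  have hqz : q ∉ s.zeros :=
    SphericalGL.notMem_zeros_of_inner_nonpos hc (hf.inner_neg_of_mem_opposite_hull hc hq.2).le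
  have hcover := Set.inter_eq_left.2 (hf.criticalSet_subset hc)
  exact ⟨by rw [← Set.inter_union_distrib_left, hcover],
    hf.criticalSet_inter_opposite_hull_subset hc,
    ⟨q, hq, hqz, hmax, hf.isLocalMaxAt_logNormSq hqz hmax, s.hasMorseIndex_logNormSq hqz hmax⟩,
    hf.criticalSet_inter_hull_nonempty hc, hf.criticalSet_inter_hull_diff_zeros_subset hc⟩

theorem theorem1p3 (n : ℕ) (hn : 2 ≤ n) (s : SphericalGL.HolSection n) (hs : s.IsNonzero)
    (hZ : ∃ c : SphericalGL.CP1, s.zeros ⊆ SphericalGL.openHemisphere c) :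
    -- every critical point lies in the hull `P` or in its opposite `P_∞`
    s.criticalSet =
        (s.criticalSet ∩ s.hull) ∪ (s.criticalSet ∩ SphericalGL.opposite s.hull) ∧
    -- `P_∞` contains a critical point
    (s.criticalSet ∩ SphericalGL.opposite s.hull).Nonempty ∧
    -- if `P` is not a point, the critical points in `P_∞` are in its interior
    ((¬ ∃ p, s.hull = {p}) →
      s.criticalSet ∩ SphericalGL.opposite s.hull ⊆
        SphericalGL.geodInterior (SphericalGL.opposite s.hull)) ∧
    -- some critical point in `P_∞` is a local maximum of `log |s|²`, of index 2 if non-degenerate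
    (∃ q ∈ s.criticalSet ∩ SphericalGL.opposite s.hull,
      q ∉ s.zeros ∧ SphericalGL.IsLocalMaxAt s.logNormSq q ∧
      (SphericalGL.IsNondegenerateAt s.logNormSq q →
        SphericalGL.HasMorseIndex s.logNormSq q 2)) ∧
    -- if `|s|²` has only non-degenerate critical points, `P` contains critical points of `s`,
    -- all of them in its interior
    ((∀ p, SphericalGL.IsCriticalPt s.normSq p → SphericalGL.IsNondegenerateAt s.normSq p) →
      (s.criticalSet ∩ s.hull).Nonempty ∧
      s.criticalSet ∩ s.hull ⊆ SphericalGL.geodInterior s.hull) := by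
  obtain ⟨hcover, hopp, ⟨q, hq, hqz, -, hloc, hmorse⟩, hne, hint⟩ :=
    theorem1p3_general n (by omega) s hs hZ
  exact ⟨hcover, ⟨q, hq⟩, fun _ => hopp, ⟨q, hq, hqz, hloc, hmorse⟩, fun hnd => ⟨hne hn, fun p hp =>
    hint ⟨hp, fun hz => SphericalGL.HolSection.notMem_criticalSet_of_mem_zeros hnd hz hp.1⟩⟩⟩
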